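/- Let $V$ be the finite or countably infinite vertex set of a graph. \emph{Blocking RSA} on $V$ is the following process. Let $(\tau_v)_{v\in V}$ be independent random variables, each uniform on $(0,1)$. If $V$ is finite, all sites are vacant initially, a particle arrives at each site $v$ at time $\tau_v$, and $v$ becomes (and then stays) occupied at time $\tau_v$ if and only if none of its neighbours is already occupied; $X_t^V(v)\in\{0,1\}$ is $1$ if $v$ is occupied at time $t$ and $0$ if it is vacant. If $V$ is infinite, $X_t^V(v)=\lim_n X_t^{V_n}(v)$ for finite sets $V_n\subseteq V$ (carrying the induced graphs and the same arrival times) with $\liminf_n V_n=V$. The vertex set $V$ is a \emph{bipartite lattice} if the graph is bipartite and for all $v_1,v_2,w_1,w_2\in V$ with $v_1$ adjacent to $v_2$ and $w_1$ adjacent to $w_2$ there is a graph automorphism sending $v_i$ to $w_i$ for $i=1,2$. \textbf{Theorem.} Consider blocking RSA on a bipartite lattice $V$ (finite or countably infinite) all of whose vertices have degree $k+1$, where $k\ge 2$. Almost surely, the limit $X_t^V(v)$ exists for all $v\in V$ and $t\in[0,1]$ and all sequences $(V_n)$ as above, and it does not depend on the sequence. For every $v\in V$ and every $t\in[0,1]$,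 $$P[X_t^V(v)=0]\le \frac12\left(1+\frac{1}{(1+(k-1)t)^{2/(k-1)}}\right).$$ In particular, at jamming ($t=1$), $$P[X_1^V(v)=0]\le \tfrac12\left(1+k^{-2/(k-1)}\right),\qquad P[X_1^V(v)=1]\ge \tfrac12\left(1-k^{-2/(k-1)}\right).$$ The integer lattice $\mathbb Z^d$ (edges between points at Euclidean distance $1$) is a bipartite lattice with all degrees $2d$, and the hexagonal lattice is a bipartite lattice with all degrees $3$. Hence, for every vertex $v$: on $\mathbb Z^2$, $P[X_t(v)=0]\le \frac{1+t}{1+2t}$ for $t\in[0,1]$ and $P[X_1(v)=1]\ge \frac13$; on the hexagonal lattice, $P[X_1(v)=1]\ge\frac38$; on $\mathbb Z^3$, $P[X_1(v)=1]\ge\frac12(1-5^{-1/2})$, which is $0.2764$ to four decimal places; and on $\mathbb Z^4$, $P[X_1(v)=1]\ge\frac12(1-7^{-1/3})$, which is $0.2386$ to four decimal places. -/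

import Mathlib

open MeasureTheory ProbabilityTheory Filter Topology

namespace BlockingRSA

/-- Acceptance in blocking RSA on the subgraph of `G` induced by the finite vertex set `A`, with
arrival time `τ v` at `v`: the particle arriving at the site `v` of `A` is accepted if and only if
no neighbour of `v` in `A` has been occupied before time `τ v`, that is, no neighbour with an
earlier arrival has been accepted. -/
def Accepted {V : Type*} (G : SimpleGraph V) (A : Finset V) (τ : V → ℝ) (v : V) : Prop :=
  v ∈ A ∧ ∀ u, u ∈ A → G.Adj u v → τ u < τ v → ¬ Accepted G A τ u
termination_by (A.filter fun u => τ u < τ v).card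
decreasing_by
  rename_i hu _ huv
  refine Finset.card_lt_card ?_
  refine (Finset.ssubset_iff_of_subset ?_).2 ⟨u, ?_, ?_⟩
  · intro w hw
    rw [Finset.mem_filter] at hw ⊢
    exact ⟨hw.1, hw.2.trans huv⟩
  · exact Finset.mem_filter.2 ⟨hu, huv⟩
  · simp

open Classical in
/-- The state at time `t` of the site `v` for blocking RSA on the subgraph of `G` induced by the
finite vertex set `A`, with arrival times `τ`: the value is `1` (occupied) if a particle has
arrived at `v` by time `t` and was accepted, and `0` (vacant) otherwise. -/
noncomputable def stateOn {V : Type*} (G : SimpleGraph V) (A : Finset V) (τ : V → ℝ) (t : ℝ)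
    (v : V) : Fin 2 :=
  if τ v ≤ t ∧ Accepted G A τ v then 1 else 0

/-- The state at time `t` of the site `v` for blocking RSA on the whole of the (finite or infinite)
graph `G` with arrival times `τ`: the limit of the states for blocking RSA on finite vertex sets
`A`, as `A` increases to the whole vertex set. When the vertex set is finite, this is the state for
`A` equal to the whole vertex set. -/
noncomputable def state {V : Type*} (G : SimpleGraph V) (τ : V → ℝ) (t : ℝ) (v : V) : Fin 2 :=
  limUnder (atTop : Filter (Finset V)) fun A => stateOn G A τ t v

/-- Arrival times: independent random variables, uniformly distributed on `(0, 1)`. -/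
structure IsArrivalTimes {Ω V : Type*} [MeasurableSpace Ω] (P : Measure Ω) (τ : V → Ω → ℝ) :
    Prop where
  measurable : ∀ v, Measurable (τ v)
  indep : iIndepFun τ P
  uniform : ∀ v, pdf.IsUniform (τ v) (Set.Ioo (0 : ℝ) 1) P

/-- Bipartite lattices: bipartite graphs whose automorphisms act transitively on ordered pairs of
adjacent vertices. -/
structure IsBipartiteLattice {V : Type*} (G : SimpleGraph V) : Prop where
  bipartite : G.IsBipartite
  transitive : ∀ v₁ v₂ w₁ w₂ : V, G.Adj v₁ v₂ → G.Adj w₁ w₂ →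
    ∃ φ : G ≃g G, φ v₁ = w₁ ∧ φ v₂ = w₂

/-- The integer lattice `ℤ^d`, with edges between the points at Euclidean distance one. -/
def integerLattice (d : ℕ) : SimpleGraph (Fin d → ℤ) where
  Adj x y := ∑ i, (x i - y i) ^ 2 = 1
  symm := ⟨fun x y h => by
    rw [← h]
    exact Finset.sum_congr rfl fun i _ => by ring⟩
  loopless := ⟨fun x h => by simp at h⟩

/-- The hexagonal (honeycomb) lattice, as two interpenetrating triangular lattices: `(a, b, false)`
stands for the point `a • e₁ + b • e₂`, and `(a, b, true)` for `a • e₁ + b • e₂ + (e₁ + e₂) / 3`,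
where `e₁`, `e₂` are unit vectors at an angle of 60 degrees. The point `(a, b, false)` has the three
nearest neighbours `(a, b, true)`, `(a - 1, b, true)` and `(a, b - 1, true)`. -/
def hexagonalLattice : SimpleGraph (ℤ × ℤ × Bool) :=
  SimpleGraph.fromRel fun x y => x.2.2 = false ∧ y.2.2 = true ∧
    ((y.1 = x.1 ∧ y.2.1 = x.2.1) ∨ (y.1 = x.1 - 1 ∧ y.2.1 = x.2.1) ∨
      (y.1 = x.1 ∧ y.2.1 = x.2.1 - 1))

end BlockingRSA

/-!
Write `N v` for the set of neighbours of `v`, and realise the arrival times as coordinates of a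
product space. All arguments take place on finite vertex sets and then pass to the limit.

*Existence of the limit.* Whether the particle at `v` is accepted depends only on the sites that are
reached from `v` by paths along which the arrival times decrease. The probability that there is such
a path with `n` edges is at most `d ^ n / n!` for degree `d`, so almost surely these paths have
bounded length (`measure_descendingPath_le`), and the states are eventually constant
(`ae_tendsto_state`).

*Positive correlation.* On a bipartite graph, early arrivals in one class and late arrivals in the
other favour occupation in the first class (`accepted_comparison`). By Harris' inequality, the
vacancy events at sites of the same class are therefore positively correlated.

*Rates.* Conditioning on the arrival time at `v`, the rate at which `v` becomes occupied at time `s`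
is the probability that all sites of `N v` are vacant at time `s` in the graph without `v`
(`one_sub_vacantProb`). For adjacent `v` and `w`, let `q` be the probability that `w` is vacant in
the graph without `v`, which by arc-transitivity is the same for all arcs (`vacantProb_iso`), and let
`g` be the probability that the sites of `N v` other than `w` are vacant in the graph without `v` and
`w`; then `q' = -g`.
* By Harris' inequality, and since removing `w` favours vacancy in the class of `w`, we have
  `g ≥ q ^ k` (`prod_vacantProb_le`), whence `q ^ (k - 1) ≤ 1 / (1 + (k - 1) t)`
  (`pow_le_of_integral_ineq`).
* As long as `w` is vacant, it has no influence on the other sites. Hence, in the graph without `v`,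
  all of `N v` is vacant if `w` is vacant there and the other sites of `N v` are vacant in the graph
  without `w` as well; Harris' inequality gives the lower bound `q * g` for the rate at `v`
  (`vacantProb_mul_le`).

Since `q * g = -(q ^ 2 / 2)'`, the site `v` is occupied at time `t` with probability at least
`(1 - q t ^ 2) / 2`. It is essential not to bound the rate by `q ^ (k + 1)`, because `q` is only
bounded from above.
-/

namespace BlockingRSA

variable {V : Type*} {G : SimpleGraph V}

/-! ### The acceptance recursion on finite vertex sets -/

lemma accepted_iff {A : Finset V} {x : V → ℝ} {v : V} :
    Accepted G A x v ↔ v ∈ A ∧ ∀ u, u ∈ A → G.Adj u v → x u < x v → ¬ Accepted G A x u := by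
  rw [Accepted]

lemma Accepted.mem {A : Finset V} {x : V → ℝ} {v : V} (h : Accepted G A x v) : v ∈ A :=
  (accepted_iff.1 h).1

/-- Induction along the order of arrival in a finite vertex set. -/
lemma arrival_induction (A : Finset V) (x : V → ℝ) {p : V → Prop}
    (h : ∀ u ∈ A, (∀ w ∈ A, x w < x u → p w) → p u) : ∀ u ∈ A, p u := by
  suffices H : ∀ n : ℕ, ∀ u ∈ A, (A.filter fun w => x w < x u).card = n → p u from
    fun u hu => H _ u hu rfl
  intro n
  induction n using Nat.strong_induction_on with
  | _ n ih =>
    intro u hu hn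
    refine h u hu fun w hw hwu => ih _ ?_ w hw rfl
    rw [← hn]
    refine Finset.card_lt_card ((Finset.ssubset_iff_of_subset ?_).2 ⟨w, ?_, ?_⟩)
    · intro z hz
      rw [Finset.mem_filter] at hz ⊢
      exact ⟨hz.1, hz.2.trans hwu⟩
    · exact Finset.mem_filter.2 ⟨hw, hwu⟩
    · simp

/-- Two processes accept the same particles in a set `D` of sites, provided that they agree on
membership in `D` and on the earlier neighbours of the sites of `D`, which again lie in `D`. -/
lemma accepted_congr {A B : Finset V} {x y : V → ℝ} (D : V → Prop)
    (hmem : ∀ u, D u → (u ∈ A ↔ u ∈ B))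
    (hadj : ∀ u, D u → ∀ w, G.Adj w u → (w ∈ A ∧ x w < x u ↔ w ∈ B ∧ y w < y u))
    (hD : ∀ u, D u → ∀ w, G.Adj w u → w ∈ A → x w < x u → D w) (u : V) (hu : D u) :
    Accepted G A x u ↔ Accepted G B y u := by
  by_cases huA : u ∈ A
  swap
  · exact iff_of_false (fun h => huA h.mem) fun h => huA ((hmem u hu).2 h.mem)
  refine arrival_induction A x (p := fun u => D u → (Accepted G A x u ↔ Accepted G B y u))
    ?_ u huA hu
  intro u huA ih hu
  rw [accepted_iff, accepted_iff (A := B)]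
  refine and_congr (hmem u hu) (forall_congr' fun w => ?_)
  constructor
  · intro h hwB hwu hy
    obtain ⟨hwA, hx⟩ := (hadj u hu w hwu).2 ⟨hwB, hy⟩
    rw [← ih w hwA hx (hD u hu w hwu hwA hx)]
    exact h hwA hwu hx
  · intro h hwA hwu hx
    obtain ⟨hwB, hy⟩ := (hadj u hu w hwu).1 ⟨hwA, hx⟩
    rw [ih w hwA hx (hD u hu w hwu hwA hx)]
    exact h hwB hwu hy

lemma accepted_congr_times {A : Finset V} {x y : V → ℝ} (h : ∀ w ∈ A, x w = y w) (u : V) :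
    Accepted G A x u ↔ Accepted G A y u := by
  by_cases hu : u ∈ A
  · refine accepted_congr (· ∈ A) (fun _ _ => Iff.rfl) (fun u hu w _ => and_congr_right fun hw => ?_)
      (fun _ _ w _ hw _ => hw) u hu
    rw [h u hu, h w hw]
  · exact iff_of_false (fun h => hu h.mem) fun h => hu h.mem

/-- A site does not influence the sites at which particles arrive earlier. -/
lemma accepted_erase_of_le [DecidableEq V] {A : Finset V} {x : V → ℝ} {u v : V} (huv : u ≠ v)
    (h : x u ≤ x v) :
    Accepted G A x u ↔ Accepted G (A.erase v) x u := by
  refine accepted_congr (fun z => z ≠ v ∧ x z ≤ x v) ?_ ?_ ?_ u ⟨huv, h⟩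
  · intro z hz
    simp [hz.1]
  · rintro z ⟨-, hz⟩ w -
    constructor
    · rintro ⟨hw, hwz⟩
      exact ⟨Finset.mem_erase.2 ⟨fun e => by subst e; exact absurd hwz hz.not_gt, hw⟩, hwz⟩
    · rintro ⟨hw, hwz⟩
      exact ⟨Finset.mem_of_mem_erase hw, hwz⟩
  · rintro z ⟨-, hz⟩ w - - hwz
    exact ⟨fun e => by subst e; exact absurd hwz hz.not_gt, hwz.le.trans hz⟩

/-- A site that rejects its particle does not influence the other sites. -/
lemma accepted_erase_of_not_accepted [DecidableEq V] {A : Finset V} {x : V → ℝ} {u w : V}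
    (huw : u ≠ w)
    (h : ¬ Accepted G A x w) : Accepted G A x u ↔ Accepted G (A.erase w) x u := by
  by_cases huA : u ∈ A
  swap
  · exact iff_of_false (fun h => huA h.mem) fun h => huA (Finset.mem_of_mem_erase h.mem)
  refine arrival_induction A x
    (p := fun u => u ≠ w → (Accepted G A x u ↔ Accepted G (A.erase w) x u)) ?_ u huA huw
  intro u huA ih huw
  rw [accepted_iff, accepted_iff (A := A.erase w)]
  refine and_congr (by simp [huw]) (forall_congr' fun z => ?_)
  constructor
  · intro H hz hzu hx
    rw [Finset.mem_erase] at hz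
    rw [← ih z hz.2 hx hz.1]
    exact H hz.2 hzu hx
  · intro H hz hzu hx
    by_cases hzw : z = w
    · rwa [hzw]
    · rw [ih z hz hx hzw]
      exact H (Finset.mem_erase.2 ⟨hzw, hz⟩) hzu hx

/-- Acceptance at `v` in terms of the process without `v`: the recursion that removes one site at a
time, used to integrate out the arrival time at `v`. -/
lemma accepted_iff_erase [DecidableEq V] {A : Finset V} {x : V → ℝ} {v : V} :
    Accepted G A x v ↔
      v ∈ A ∧ ∀ u ∈ A, G.Adj u v → x u < x v → ¬ Accepted G (A.erase v) x u := by
  rw [accepted_iff]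
  refine and_congr_right fun _ => forall_congr' fun u => forall_congr' fun _ =>
    forall_congr' fun huv => forall_congr' fun hx => ?_
  rw [accepted_erase_of_le huv.ne hx.le]

lemma accepted_update_iff [DecidableEq V] {A : Finset V} {x : V → ℝ} {v : V} {s : ℝ} :
    Accepted G A (Function.update x v s) v ↔
      v ∈ A ∧ ∀ u ∈ A, G.Adj u v → ¬ (x u < s ∧ Accepted G (A.erase v) x u) := by
  rw [accepted_iff_erase]
  refine and_congr_right fun _ => forall_congr' fun u => forall_congr' fun _ =>
    forall_congr' fun huv => ?_
  have h1 : Accepted G (A.erase v) (Function.update x v s) u ↔ Accepted G (A.erase v) x u :=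
    accepted_congr_times (fun w hw => Function.update_of_ne (Finset.ne_of_mem_erase hw) _ _) u
  rw [h1, Function.update_self, Function.update_of_ne huv.ne, not_and]

/-! ### Monotonicity on bipartite graphs -/

/-- Monotonicity on a bipartite graph: earlier arrivals at, and more sites in, the class `c`,
together with later arrivals at, and fewer sites in, the other class, favour acceptance in the
class `c` and hinder it in the other one. -/
lemma accepted_comparison {A B : Finset V} {x y : V → ℝ} {c : V → Prop}
    (hc : ∀ u w, G.Adj u w → (c u ↔ ¬ c w))
    (hBA : ∀ u, c u → u ∈ B → u ∈ A) (hAB : ∀ u, ¬ c u → u ∈ A → u ∈ B)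
    (hxy : ∀ u, c u → x u ≤ y u) (hyx : ∀ u, ¬ c u → y u ≤ x u) (u : V) :
    (c u → Accepted G B y u → Accepted G A x u) ∧
      (¬ c u → Accepted G A x u → Accepted G B y u) := by
  have key : ∀ u ∈ B, (c u → Accepted G B y u → Accepted G A x u) ∧
      (¬ c u → Accepted G A x u → Accepted G B y u) := by
    refine arrival_induction B y fun u hu ih => ⟨fun hcu h => ?_, fun hcu h => ?_⟩
    · refine accepted_iff.2 ⟨hBA u hcu hu, fun z hz hzu hlt hacc => ?_⟩
      have hcz : ¬ c z := fun hcz => (hc z u hzu).1 hcz hcu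
      have hzB := hAB z hcz hz
      have hlt' : y z < y u := ((hyx z hcz).trans_lt hlt).trans_le (hxy u hcu)
      exact (accepted_iff.1 h).2 z hzB hzu hlt' ((ih z hzB hlt').2 hcz hacc)
    · refine accepted_iff.2 ⟨hu, fun z hz hzu hlt hacc => ?_⟩
      have hcz : c z := (hc z u hzu).2 hcu
      exact (accepted_iff.1 h).2 z (hBA z hcz hz) hzu
        (((hxy z hcz).trans_lt hlt).trans_le (hyx u hcu)) ((ih z hz hlt).1 hcz hacc)
  exact ⟨fun hcu h => (key u h.mem).1 hcu h, fun hcu h => (key u (hAB u hcu h.mem)).2 hcu h⟩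

/-! ### Measurability and descending paths -/

lemma measurableSet_accepted [Countable V] (A : Finset V) (v : V) :
    MeasurableSet {x : V → ℝ | Accepted G A x v} := by
  classical
  induction hn : A.card generalizing A v with
  | zero =>
    rw [Finset.card_eq_zero] at hn
    subst hn
    convert MeasurableSet.empty
    exact Set.eq_empty_of_forall_notMem fun x hx => absurd (Accepted.mem hx) (Finset.notMem_empty v)
  | succ n ih =>
    by_cases hv : v ∈ A
    · have hcard : (A.erase v).card = n := by rw [Finset.card_erase_of_mem hv, hn]; rfl
      have heq : {x : V → ℝ | Accepted G A x v} = {x | ∀ u ∈ A, G.Adj u v → x u < x v →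
          ¬ Accepted G (A.erase v) x u} := by
        ext x
        exact accepted_iff_erase.trans (and_iff_right hv)
      rw [heq]
      exact measurableSet_setOfPred.2 <| Measurable.forall fun u => measurable_const.imp <|
        measurable_const.imp <| Measurable.imp
          (measurableSet_setOfPred.1 (measurableSet_lt (measurable_pi_apply u) (measurable_pi_apply v)))
          (measurableSet_setOfPred.1 (ih _ u hcard)).not
    · convert MeasurableSet.empty
      exact Set.eq_empty_of_forall_notMem fun x hx => hv (Accepted.mem hx)

/-- `DescendingPath G x n v`: there is a path of `n` edges in `G` that starts at `v` and along which
the times `x` decrease strictly. -/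
def DescendingPath (G : SimpleGraph V) (x : V → ℝ) : ℕ → V → Prop
  | 0, _ => True
  | n + 1, v => ∃ u, G.Adj u v ∧ x u < x v ∧ DescendingPath G x n u

lemma measurableSet_descendingPath [Countable V] (n : ℕ) (v : V) :
    MeasurableSet {x : V → ℝ | DescendingPath G x n v} := by
  induction n generalizing v with
  | zero => exact .const _
  | succ n ih =>
    have heq : {x : V → ℝ | DescendingPath G x (n + 1) v} =
        ⋃ u, {x | G.Adj u v} ∩ ({x | x u < x v} ∩ {x | DescendingPath G x n u}) := by
      ext x
      simp only [Set.mem_iUnion]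
      rfl
    rw [heq]
    exact MeasurableSet.iUnion fun u => .inter (.const _) <|
      .inter (measurableSet_lt (measurable_pi_apply u) (measurable_pi_apply v)) (ih u)

/-- A descending path that starts below time `s` does not visit a site with time `s`. -/
lemma descendingPath_of_update [DecidableEq V] {x : V → ℝ} {v : V} {s : ℝ} (n : ℕ) {u : V}
    (huv : u ≠ v) (hu : x u < s) (h : DescendingPath G (Function.update x v s) n u) :
    DescendingPath G x n u := by
  induction n generalizing u with
  | zero => trivial
  | succ n ih =>
    obtain ⟨w, hwu, hlt, hw⟩ := h
    rw [Function.update_of_ne huv] at hlt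
    have hwv : w ≠ v := by
      rintro rfl
      rw [Function.update_self] at hlt
      exact absurd hlt hu.not_gt
    rw [Function.update_of_ne hwv] at hlt
    exact ⟨w, hwu, hlt, ih hwv (hlt.trans hu) hw⟩

/-- If the descending paths from `v` have bounded length, then the fate of the particle arriving at
`v` is determined by the sites in some finite set. -/
lemma exists_finset_accepted_iff (hG : ∀ v, (G.neighborSet v).Finite) {x : V → ℝ} (n : ℕ) {v : V}
    (h : ¬ DescendingPath G x n v) :
    ∃ F : Finset V, ∀ A B : Finset V, (∀ z ∈ F, z ∈ A ↔ z ∈ B) →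
      (Accepted G A x v ↔ Accepted G B x v) := by
  classical
  induction n generalizing v with
  | zero => exact absurd trivial h
  | succ n ih =>
    have H : ∀ u, G.Adj u v → x u < x v → ∃ F : Finset V, ∀ A B : Finset V,
        (∀ z ∈ F, z ∈ A ↔ z ∈ B) → (Accepted G A x u ↔ Accepted G B x u) :=
      fun u huv hlt => ih fun hu => h ⟨u, huv, hlt, hu⟩
    choose! F hF using H
    refine ⟨insert v ((hG v).toFinset ∪ (hG v).toFinset.biUnion F), fun A B hAB => ?_⟩
    rw [accepted_iff, accepted_iff (A := B)]
    refine and_congr (hAB v (Finset.mem_insert_self _ _)) (forall_congr' fun u => ?_)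
    by_cases huv : G.Adj u v
    swap
    · simp [huv]
    have hu : u ∈ (hG v).toFinset := by simpa using huv.symm
    refine imp_congr (hAB u (by simp [huv.symm])) (imp_congr_right fun _ =>
      imp_congr_right fun hlt => not_congr (hF u huv hlt A B fun z hz => hAB z ?_))
    exact Finset.mem_insert_of_mem (Finset.mem_union_right _ (Finset.mem_biUnion.2 ⟨u, hu, hz⟩))

/-! ### The law of the arrival times -/

/-- The uniform distribution on `(0, 1)`. -/
noncomputable def unif : Measure ℝ := volume.restrict (Set.Ioo 0 1)

instance : IsProbabilityMeasure unif := ⟨by simp [unif]⟩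

/-- The joint law of the arrival times. -/
noncomputable def arrivalLaw (V : Type*) : Measure (V → ℝ) := Measure.infinitePi fun _ => unif

instance : IsProbabilityMeasure (arrivalLaw V) := by unfold arrivalLaw; infer_instance

lemma IsArrivalTimes.map_eq {Ω : Type*} [MeasurableSpace Ω] {P : Measure Ω}
    [IsProbabilityMeasure P] {τ : V → Ω → ℝ} (h : IsArrivalTimes P τ) :
    P.map (fun ω v => τ v ω) = arrivalLaw V := by
  rw [h.indep.map_fun_eq_infinitePi_map h.measurable]
  unfold arrivalLaw
  congr 1
  funext v
  rw [h.uniform v, ProbabilityTheory.cond, unif]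
  simp

lemma arrivalLaw_map_comp (e : V ≃ V) :
    (arrivalLaw V).map (fun x => x ∘ e) = arrivalLaw V := by
  unfold arrivalLaw
  have := Measure.map_infinitePi_infinitePi_of_inj (P := fun _ : V => unif) e.injective
  exact this

lemma ae_mem_Ioo [Countable V] : ∀ᵐ x ∂arrivalLaw V, ∀ v, x v ∈ Set.Ioo (0 : ℝ) 1 := by
  refine ae_all_iff.2 fun v => ?_
  have h : ∀ᵐ s ∂unif, s ∈ Set.Ioo (0 : ℝ) 1 := ae_restrict_mem measurableSet_Ioo
  rw [← measurePreserving_eval_infinitePi (fun _ : V => unif) v |>.map_eq] at h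
  exact ae_of_ae_map (measurable_pi_apply v).aemeasurable h

section Resampling

variable [DecidableEq V]

lemma measurable_update_prod (v : V) :
    Measurable fun p : ℝ × (V → ℝ) => Function.update p.2 v p.1 := by
  refine measurable_pi_iff.2 fun w => ?_
  by_cases hw : w = v
  · subst hw; simpa using measurable_fst
  · simpa [Function.update_of_ne hw] using! (measurable_pi_apply w).comp measurable_snd

/-- Resampling one coordinate does not change the law. -/
lemma arrivalLaw_map_update (v : V) :
    (unif.prod (arrivalLaw V)).map (fun p => Function.update p.2 v p.1) = arrivalLaw V := by
  refine Measure.eq_infinitePi _ fun s t ht => ?_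
  rw [Measure.map_apply (measurable_update_prod v) (.pi s.countable_toSet fun i _ => ht i)]
  by_cases hv : v ∈ s
  · have : (fun p : ℝ × (V → ℝ) => Function.update p.2 v p.1) ⁻¹' (Set.pi s t) =
        t v ×ˢ Set.pi (s.erase v) t := by
      ext ⟨r, x⟩
      simp only [Set.mem_preimage, Set.mem_pi, Set.mem_prod, Finset.mem_coe, Finset.mem_erase]
      constructor
      · intro h
        refine ⟨by simpa using h v hv, fun i hi => ?_⟩
        simpa [Function.update_of_ne hi.1] using h i hi.2
      · rintro ⟨h1, h2⟩ i hi
        by_cases hiv : i = v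
        · subst hiv; simpa using h1
        · simpa [Function.update_of_ne hiv] using h2 i ⟨hiv, hi⟩
    rw [this, Measure.prod_prod, arrivalLaw, Measure.infinitePi_pi _ fun i _ => ht i,
      Finset.mul_prod_erase s (fun i => unif (t i)) hv]
  · have : (fun p : ℝ × (V → ℝ) => Function.update p.2 v p.1) ⁻¹' (Set.pi s t) =
        Set.univ ×ˢ Set.pi s t := by
      ext ⟨r, x⟩
      simp only [Set.mem_preimage, Set.mem_pi, Set.mem_prod, Finset.mem_coe, Set.mem_univ, true_and]
      refine forall₂_congr fun i hi => ?_
      rw [Function.update_of_ne fun e : i = v => hv (e ▸ hi)]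
    rw [this, Measure.prod_prod, arrivalLaw, Measure.infinitePi_pi _ fun i _ => ht i]
    simp

lemma arrivalLaw_apply_update (v : V) {E : Set (V → ℝ)} (hE : MeasurableSet E) :
    arrivalLaw V E = ∫⁻ s, arrivalLaw V {x | Function.update x v s ∈ E} ∂unif := by
  conv_lhs => rw [← arrivalLaw_map_update v, Measure.map_apply (measurable_update_prod v) hE]
  rw [Measure.prod_apply (measurable_update_prod v hE)]
  rfl

lemma integral_update (v : V) {f : (V → ℝ) → ℝ} (hf : Measurable f) (h0 : ∀ x, 0 ≤ f x)
    (h1 : ∀ x, f x ≤ 1) :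
    ∫ x, ∫ s, f (Function.update x v s) ∂unif ∂arrivalLaw V = ∫ x, f x ∂arrivalLaw V := by
  conv_rhs => rw [← arrivalLaw_map_update v,
    integral_map (measurable_update_prod v).aemeasurable hf.aestronglyMeasurable]
  rw [integral_prod_symm]
  refine Integrable.of_bound (hf.comp (measurable_update_prod v)).aestronglyMeasurable 1
    (ae_of_all _ fun p => ?_)
  rw [Real.norm_eq_abs, abs_le]
  exact ⟨by linarith [h0 (Function.update p.2 v p.1)], h1 _⟩

lemma measureReal_update (v : V) {E : Set (V → ℝ)} (hE : MeasurableSet E) :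
    (arrivalLaw V).real E =
      ∫ s, (arrivalLaw V).real {x | Function.update x v s ∈ E} ∂unif := by
  rw [Measure.real, arrivalLaw_apply_update v hE, ← integral_toReal]
  · rfl
  · exact (measurable_measure_prodMk_left (measurable_update_prod v hE)).aemeasurable
  · exact ae_of_all _ fun s => measure_lt_top _ _

end Resampling

/-! ### Harris' inequality -/

/-- Chebyshev's inequality for similarly ordered functions: they are positively correlated. -/
lemma integral_mul_integral_le {α : Type*} [MeasurableSpace α] (μ : Measure α)
    [IsProbabilityMeasure μ] {f g : α → ℝ} (hf : Integrable f μ) (hg : Integrable g μ)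
    (hfg : Integrable (fun a => f a * g a) μ) (h : ∀ a b, 0 ≤ (f a - f b) * (g a - g b)) :
    (∫ a, f a ∂μ) * ∫ a, g a ∂μ ≤ ∫ a, f a * g a ∂μ := by
  have h1 : ∀ a, 0 ≤ f a * g a - f a * (∫ b, g b ∂μ) - g a * (∫ b, f b ∂μ) +
      ∫ b, f b * g b ∂μ := by
    intro a
    have h2 : ∫ b, (f a - f b) * (g a - g b) ∂μ = f a * g a - f a * (∫ b, g b ∂μ) -
        g a * (∫ b, f b ∂μ) + ∫ b, f b * g b ∂μ := by
      have h3 : ∀ b, (f a - f b) * (g a - g b) =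
          f a * g a - f a * g b - g a * f b + f b * g b := fun b => by ring
      simp_rw [h3]
      rw [integral_add (by fun_prop) hfg, integral_sub (by fun_prop) (by fun_prop),
        integral_sub (by fun_prop) (by fun_prop), integral_const_mul, integral_const_mul]
      simp [integral_const_mul]
    rw [← h2]
    exact integral_nonneg fun b => h a b
  have h4 := integral_nonneg (μ := μ) (Pi.le_def.2 h1)
  rw [integral_add (by fun_prop) (by fun_prop), integral_sub (by fun_prop) (by fun_prop),
    integral_sub hfg (by fun_prop), integral_mul_const, integral_mul_const] at h4
  simp only [integral_const, probReal_univ, one_smul] at h4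
  linarith

/-- Functions of the arrival times that increase with the times at the sites in `c`, and decrease
with the times at the other sites. -/
def SignedMono (c : V → Prop) (f : (V → ℝ) → ℝ) : Prop :=
  ∀ x y : V → ℝ, (∀ v, c v → x v ≤ y v) → (∀ v, ¬ c v → y v ≤ x v) → f x ≤ f y

/-- Harris' inequality for functions of finitely many independent arrival times: functions that are
monotone in the same sense in each of the coordinates are positively correlated. -/
theorem harris {c : V → Prop} (S : Finset V) {f g : (V → ℝ) → ℝ} (hf : Measurable f)
    (hg : Measurable g) (hf0 : ∀ x, 0 ≤ f x) (hf1 : ∀ x, f x ≤ 1) (hg0 : ∀ x, 0 ≤ g x)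
    (hg1 : ∀ x, g x ≤ 1) (hfm : SignedMono c f) (hgm : SignedMono c g)
    (hfS : DependsOn f (S : Set V)) (hgS : DependsOn g (S : Set V)) :
    (∫ x, f x ∂arrivalLaw V) * ∫ x, g x ∂arrivalLaw V ≤ ∫ x, f x * g x ∂arrivalLaw V := by
  classical
  induction S using Finset.induction_on generalizing f g with
  | empty =>
    have hf' : f = fun _ => f 0 := funext fun x => hfS (by simp)
    have hg' : g = fun _ => g 0 := funext fun x => hgS (by simp)
    rw [hf', hg']
    simp
  | insert v S hv ih =>
    have key : ∀ {f : (V → ℝ) → ℝ}, Measurable f → (∀ x, 0 ≤ f x) → (∀ x, f x ≤ 1) →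
        (∀ x, Integrable (fun s => f (Function.update x v s)) unif) ∧
        Measurable (fun x => ∫ s, f (Function.update x v s) ∂unif) ∧
        (∀ x, 0 ≤ ∫ s, f (Function.update x v s) ∂unif) ∧
        (∀ x, ∫ s, f (Function.update x v s) ∂unif ≤ 1) := by
      intro f hf h0 h1
      have hint : ∀ x, Integrable (fun s => f (Function.update x v s)) unif := fun x =>
        Integrable.of_bound (hf.comp (measurable_update x)).aestronglyMeasurable 1
          (ae_of_all _ fun s => by
            rw [Real.norm_eq_abs, abs_le]
            exact ⟨by linarith [h0 (Function.update x v s)], h1 _⟩)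
      refine ⟨hint, ?_, fun x => integral_nonneg fun s => h0 _, fun x => ?_⟩
      · exact (StronglyMeasurable.integral_prod_left (μ := unif)
          (f := fun s x => f (Function.update x v s))
          (hf.comp (measurable_update_prod v)).stronglyMeasurable).measurable
      · calc ∫ s, f (Function.update x v s) ∂unif ≤ ∫ _, (1 : ℝ) ∂unif :=
              integral_mono (hint x) (integrable_const _) fun s => h1 _
          _ = 1 := by simp
    have mono : ∀ {f : (V → ℝ) → ℝ}, Measurable f → (∀ x, 0 ≤ f x) → (∀ x, f x ≤ 1) →
        SignedMono c f → SignedMono c fun x => ∫ s, f (Function.update x v s) ∂unif := by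
      intro f hf h0 h1 hm x y hxy hyx
      refine integral_mono ((key hf h0 h1).1 x) ((key hf h0 h1).1 y) fun s => hm _ _ ?_ ?_
      · intro w hw
        by_cases h : w = v
        · subst h; simp
        · simpa [Function.update_of_ne h] using hxy w hw
      · intro w hw
        by_cases h : w = v
        · subst h; simp
        · simpa [Function.update_of_ne h] using hyx w hw
    have dep : ∀ {f : (V → ℝ) → ℝ}, DependsOn f ((insert v S : Finset V) : Set V) →
        DependsOn (fun x => ∫ s, f (Function.update x v s) ∂unif) (S : Set V) := by
      intro f hd x y hxy
      refine integral_congr_ae (ae_of_all _ fun s => hd fun w hw => ?_)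
      by_cases h : w = v
      · subst h; simp
      · rw [Function.update_of_ne h, Function.update_of_ne h]
        exact hxy w (by simpa [h] using hw)
    -- integrate out the coordinate `v`: Chebyshev's inequality in that coordinate, and the
    -- induction hypothesis for the functions of the other coordinates
    obtain ⟨hfi, hfF, hf0', hf1'⟩ := key hf hf0 hf1
    obtain ⟨hgi, hgF, hg0', hg1'⟩ := key hg hg0 hg1
    have hfg0 : ∀ x, 0 ≤ f x * g x := fun x => mul_nonneg (hf0 x) (hg0 x)
    have hfg1 : ∀ x, f x * g x ≤ 1 := fun x => mul_le_one₀ (hf1 x) (hg0 x) (hg1 x)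
    obtain ⟨hfgi, hfgF, hfg0', hfg1'⟩ := key (f := fun x => f x * g x) (hf.mul hg) hfg0 hfg1
    have h1 := ih hfF hgF hf0' hf1' hg0' hg1' (mono hf hf0 hf1 hfm) (mono hg hg0 hg1 hgm)
      (dep hfS) (dep hgS)
    rw [integral_update v hf hf0 hf1, integral_update v hg hg0 hg1] at h1
    refine h1.trans ?_
    rw [← integral_update v (f := fun x => f x * g x) (hf.mul hg) hfg0 hfg1]
    refine integral_mono ?_ ?_ fun x => ?_
    · refine Integrable.of_bound (hfF.mul hgF).aestronglyMeasurable 1 (ae_of_all _ fun x => ?_)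
      rw [Real.norm_eq_abs, abs_le]
      exact ⟨by linarith [mul_nonneg (hf0' x) (hg0' x)],
        mul_le_one₀ (hf1' x) (hg0' x) (hg1' x)⟩
    · refine Integrable.of_bound hfgF.aestronglyMeasurable 1 (ae_of_all _ fun x => ?_)
      rw [Real.norm_eq_abs, abs_le]
      exact ⟨by linarith [hfg0' x], hfg1' x⟩
    · refine integral_mul_integral_le unif (hfi x) (hgi x) (hfgi x) fun a b => ?_
      -- both functions are monotone, or both antitone, in the coordinate `v`
      have hmono : ∀ {f : (V → ℝ) → ℝ}, SignedMono c f → ∀ a b, a ≤ b →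
          (c v → f (Function.update x v a) ≤ f (Function.update x v b)) ∧
          (¬ c v → f (Function.update x v b) ≤ f (Function.update x v a)) := by
        intro f hm a b hab
        refine ⟨fun hcv => hm _ _ (fun w hw => ?_) (fun w hw => ?_),
          fun hcv => hm _ _ (fun w hw => ?_) (fun w hw => ?_)⟩ <;>
        · by_cases h : w = v
          · subst h; first | simpa using hab | contradiction
          · simp [Function.update_of_ne h]
      rcases le_total a b with hab | hab <;> by_cases hcv : c v
      · exact mul_nonneg_of_nonpos_of_nonpos (sub_nonpos.2 ((hmono hfm a b hab).1 hcv))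
          (sub_nonpos.2 ((hmono hgm a b hab).1 hcv))
      · exact mul_nonneg (sub_nonneg.2 ((hmono hfm a b hab).2 hcv))
          (sub_nonneg.2 ((hmono hgm a b hab).2 hcv))
      · exact mul_nonneg (sub_nonneg.2 ((hmono hfm b a hab).1 hcv))
          (sub_nonneg.2 ((hmono hgm b a hab).1 hcv))
      · exact mul_nonneg_of_nonpos_of_nonpos (sub_nonpos.2 ((hmono hfm b a hab).2 hcv))
          (sub_nonpos.2 ((hmono hgm b a hab).2 hcv))

/-- Events that become more likely when the times at the sites in `c` increase and the times at the
other sites decrease. -/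
def SignedIncreasing (c : V → Prop) (E : Set (V → ℝ)) : Prop :=
  ∀ x y : V → ℝ, (∀ v, c v → x v ≤ y v) → (∀ v, ¬ c v → y v ≤ x v) → x ∈ E → y ∈ E

/-- Harris' inequality for events. -/
theorem harris_event {c : V → Prop} (S : Finset V) {E F : Set (V → ℝ)} (hE : MeasurableSet E)
    (hF : MeasurableSet F) (hEc : SignedIncreasing c E) (hFc : SignedIncreasing c F)
    (hES : DependsOn (· ∈ E) (S : Set V)) (hFS : DependsOn (· ∈ F) (S : Set V)) :
    (arrivalLaw V).real E * (arrivalLaw V).real F ≤ (arrivalLaw V).real (E ∩ F) := by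
  classical
  have h0 : ∀ (E : Set (V → ℝ)) x, 0 ≤ E.indicator (1 : (V → ℝ) → ℝ) x := fun E x =>
    Set.indicator_nonneg (fun _ _ => zero_le_one) x
  have h1 : ∀ (E : Set (V → ℝ)) x, E.indicator (1 : (V → ℝ) → ℝ) x ≤ 1 := fun E x =>
    Set.indicator_le_self' (fun _ _ => zero_le_one) x
  have hm : ∀ {E : Set (V → ℝ)}, SignedIncreasing c E → SignedMono c (E.indicator 1) := by
    intro E hE x y hxy hyx
    by_cases hx : x ∈ E
    · simp [hx, hE x y hxy hyx hx]
    · simpa [hx] using h0 E y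
  have hd : ∀ {E : Set (V → ℝ)}, DependsOn (· ∈ E) (S : Set V) →
      DependsOn (E.indicator (1 : (V → ℝ) → ℝ)) (S : Set V) := by
    intro E hE x y hxy
    have := hE hxy
    simp only [eq_iff_iff] at this
    simp [Set.indicator_apply, this]
  have H := harris S (measurable_one.indicator hE) (measurable_one.indicator hF) (h0 E) (h1 E)
    (h0 F) (h1 F) (hm hEc) (hm hFc) (hd hES) (hd hFS)
  have h2 : ∀ x, E.indicator (1 : (V → ℝ) → ℝ) x * F.indicator (1 : (V → ℝ) → ℝ) x =
      (E ∩ F).indicator (1 : (V → ℝ) → ℝ) x := by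
    intro x
    rw [Set.inter_indicator_one]
    rfl
  simp_rw [h2] at H
  rwa [integral_indicator_one hE, integral_indicator_one hF,
    integral_indicator_one (hE.inter hF)] at H

/-- Harris' inequality for finitely many events. -/
theorem harris_prod {ι : Type*} {c : V → Prop} (S : Finset V) (T : Finset ι)
    {E : ι → Set (V → ℝ)} (hE : ∀ i ∈ T, MeasurableSet (E i))
    (hEc : ∀ i ∈ T, SignedIncreasing c (E i))
    (hES : ∀ i ∈ T, DependsOn (· ∈ E i) (S : Set V)) :
    ∏ i ∈ T, (arrivalLaw V).real (E i) ≤ (arrivalLaw V).real {x | ∀ i ∈ T, x ∈ E i} := by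
  classical
  induction T using Finset.induction_on with
  | empty => simp
  | insert i T hi ih =>
    rw [Finset.prod_insert hi]
    have h1 : {x | ∀ j ∈ insert i T, x ∈ E j} = E i ∩ {x | ∀ j ∈ T, x ∈ E j} := by
      ext x; simp
    have h2 : MeasurableSet {x | ∀ j ∈ T, x ∈ E j} := by
      have : {x | ∀ j ∈ T, x ∈ E j} = ⋂ j ∈ T, E j := by ext x; simp
      rw [this]
      exact T.measurableSet_biInter fun j hj => hE j (Finset.mem_insert_of_mem hj)
    rw [h1]
    refine le_trans (mul_le_mul_of_nonneg_left (ih (fun j hj => hE j (Finset.mem_insert_of_mem hj))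
      (fun j hj => hEc j (Finset.mem_insert_of_mem hj))
      (fun j hj => hES j (Finset.mem_insert_of_mem hj))) measureReal_nonneg) ?_
    refine harris_event S (hE i (Finset.mem_insert_self _ _)) h2
      (hEc i (Finset.mem_insert_self _ _)) ?_ (hES i (Finset.mem_insert_self _ _)) ?_
    · exact fun x y hxy hyx hx j hj =>
        hEc j (Finset.mem_insert_of_mem hj) x y hxy hyx (hx j hj)
    · intro x y hxy
      simp only [eq_iff_iff, Set.mem_ofPred_eq]
      refine forall₂_congr fun j hj => ?_
      have := hES j (Finset.mem_insert_of_mem hj) hxy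
      simpa using this

/-! ### Finite dependence -/

/-- Integrating out the arrival time at `v` in an event that requires an arrival before `s`. -/
lemma arrivalLaw_lt_and_le [DecidableEq V] (v : V) (s : ℝ) {Q : (V → ℝ) → Prop}
    (hQ : MeasurableSet {x | Q x}) :
    arrivalLaw V {x | x v < s ∧ Q x} ≤
      ∫⁻ r in Set.Ioo 0 s, arrivalLaw V {x | Q (Function.update x v r)} := by
  have hm : MeasurableSet {x : V → ℝ | x v < s ∧ Q x} :=
    (measurableSet_lt (measurable_pi_apply v) measurable_const).inter hQ
  rw [arrivalLaw_apply_update v hm]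
  calc ∫⁻ r, arrivalLaw V {x | Function.update x v r ∈ {x : V → ℝ | x v < s ∧ Q x}} ∂unif
      ≤ ∫⁻ r, (Set.Iio s).indicator
          (fun r => arrivalLaw V {x | Q (Function.update x v r)}) r ∂unif := by
        refine lintegral_mono fun r => ?_
        by_cases hr : r < s
        · rw [Set.indicator_of_mem (Set.mem_Iio.2 hr)]
          exact measure_mono fun x (hx : _ ∧ _) => hx.2
        · have : {x | Function.update x v r ∈ {x : V → ℝ | x v < s ∧ Q x}} = ∅ :=
            Set.eq_empty_of_forall_notMem fun x hx => hr (by simpa using hx.1)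
          rw [this]
          simp
    _ ≤ _ := by
        rw [lintegral_indicator measurableSet_Iio]
        refine lintegral_mono' ?_ le_rfl
        rw [unif, Measure.restrict_restrict measurableSet_Iio]
        have hsub : Set.Iio s ∩ Set.Ioo 0 1 ⊆ Set.Ioo 0 s := fun r hr => ⟨hr.2.1, hr.1⟩
        exact Measure.restrict_mono hsub le_rfl

/-- The probability of a descending path of `n` edges from `v`, starting before time `s`. There are
at most `d ^ n` paths, and the `n + 1` times along a path lie in the simplex of volume
`s ^ (n + 1) / (n + 1)!`. In the induction, the time `r` at `v` is integrated out; the rest of the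
path runs below `r`, hence does not return to `v`. -/
lemma measure_descendingPath_le [DecidableEq V] [Countable V] [G.LocallyFinite] {d : ℕ}
    (hd : G.IsRegularOfDegree d) (n : ℕ) (v : V) (s : ℝ) (hs : 0 ≤ s) :
    arrivalLaw V {x | x v < s ∧ DescendingPath G x n v} ≤
      ENNReal.ofReal ((d : ℝ) ^ n * s ^ (n + 1) / (n + 1).factorial) := by
  induction n generalizing v s with
  | zero =>
    refine (arrivalLaw_lt_and_le v s (measurableSet_descendingPath 0 v)).trans ?_
    simp [DescendingPath]
  | succ n ih =>
    refine (arrivalLaw_lt_and_le v s (measurableSet_descendingPath (n + 1) v)).trans ?_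
    have h1 : ∀ r ∈ Set.Ioo 0 s,
        arrivalLaw V {x | DescendingPath G (Function.update x v r) (n + 1) v} ≤
          ENNReal.ofReal ((d : ℝ) ^ (n + 1) * r ^ (n + 1) / (n + 1).factorial) := by
      intro r hr
      calc arrivalLaw V {x | DescendingPath G (Function.update x v r) (n + 1) v}
          ≤ arrivalLaw V (⋃ u ∈ G.neighborFinset v, {x | x u < r ∧ DescendingPath G x n u}) := by
            refine measure_mono ?_
            rintro x ⟨u, huv, hlt, hu⟩
            rw [Function.update_self, Function.update_of_ne huv.ne] at hlt
            exact Set.mem_biUnion (x := u) (by simpa using huv.symm)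
              ⟨hlt, descendingPath_of_update n huv.ne hlt hu⟩
        _ ≤ ∑ u ∈ G.neighborFinset v, arrivalLaw V {x | x u < r ∧ DescendingPath G x n u} :=
            measure_biUnion_finset_le _ _
        _ ≤ ∑ u ∈ G.neighborFinset v,
              ENNReal.ofReal ((d : ℝ) ^ n * r ^ (n + 1) / (n + 1).factorial) :=
            Finset.sum_le_sum fun u _ => ih u r hr.1.le
        _ = ENNReal.ofReal ((d : ℝ) ^ (n + 1) * r ^ (n + 1) / (n + 1).factorial) := by
            rw [Finset.sum_const, SimpleGraph.card_neighborFinset_eq_degree, hd v,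
              nsmul_eq_mul, ← ENNReal.ofReal_natCast, ← ENNReal.ofReal_mul (by positivity)]
            congr 1
            ring
    refine (setLIntegral_mono' measurableSet_Ioo h1).trans ?_
    rw [← ofReal_integral_eq_lintegral_ofReal]
    · refine ENNReal.ofReal_le_ofReal (le_of_eq ?_)
      rw [← integral_Ioc_eq_integral_Ioo, ← intervalIntegral.integral_of_le hs,
        intervalIntegral.integral_div, intervalIntegral.integral_const_mul, integral_pow,
        Nat.factorial_succ (n + 1)]
      push_cast
      field_simp
      ring
    · exact (Continuous.integrableOn_Icc (by fun_prop)).mono_set Set.Ioo_subset_Icc_self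
    · filter_upwards [ae_restrict_mem measurableSet_Ioo] with r hr
      have := hr.1.le
      positivity

lemma ae_exists_not_descendingPath [Countable V] [G.LocallyFinite] {d : ℕ}
    (hd : G.IsRegularOfDegree d) :
    ∀ᵐ x ∂arrivalLaw V, ∀ v, ∃ n, ¬ DescendingPath G x n v := by
  classical
  refine ae_all_iff.2 fun v => ?_
  have h0 : arrivalLaw V {x | x v < 1 ∧ ∀ n, DescendingPath G x n v} = 0 := by
    have hle : ∀ n : ℕ, arrivalLaw V {x | x v < 1 ∧ ∀ n, DescendingPath G x n v} ≤
        ENNReal.ofReal ((d : ℝ) ^ n / n.factorial) := by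
      intro n
      have hsub : {x : V → ℝ | x v < 1 ∧ ∀ n, DescendingPath G x n v} ⊆
          {x | x v < 1 ∧ DescendingPath G x n v} := fun x hx => ⟨hx.1, hx.2 n⟩
      exact (measure_mono hsub).trans <|
        (measure_descendingPath_le hd n v 1 zero_le_one).trans <| ENNReal.ofReal_le_ofReal <| by
          rw [one_pow, mul_one]
          gcongr
          exact Nat.le_succ n
    have hlim := ENNReal.tendsto_ofReal (FloorSemiring.tendsto_pow_div_factorial_atTop (d : ℝ))
    rw [ENNReal.ofReal_zero] at hlim
    exact le_antisymm (ge_of_tendsto' hlim hle) zero_le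
  filter_upwards [ae_mem_Ioo, measure_eq_zero_iff_ae_notMem.1 h0] with x hx h
  by_contra! hcon
  exact h ⟨(hx v).2, hcon⟩

/-- Almost surely, the fate of each particle is determined by finitely many sites. -/
lemma ae_exists_finset_accepted_iff [Countable V] [G.LocallyFinite] {d : ℕ}
    (hd : G.IsRegularOfDegree d) :
    ∀ᵐ x ∂arrivalLaw V, ∀ v, ∃ F : Finset V, ∀ A B : Finset V, (∀ z ∈ F, z ∈ A ↔ z ∈ B) →
      (Accepted G A x v ↔ Accepted G B x v) := by
  filter_upwards [ae_exists_not_descendingPath hd] with x hx v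
  obtain ⟨n, hn⟩ := hx v
  exact exists_finset_accepted_iff (fun v => Set.toFinite _) n hn

/-! ### Vacancy probabilities -/

/-- The event that the site `u` is vacant just before time `s`, for blocking RSA on the finite
vertex set `A`. -/
def Vacant (G : SimpleGraph V) (A : Finset V) (s : ℝ) (u : V) : Set (V → ℝ) :=
  {x | ¬ (x u < s ∧ Accepted G A x u)}

lemma measurableSet_vacant [Countable V] (A : Finset V) (s : ℝ) (u : V) :
    MeasurableSet (Vacant G A s u) :=
  ((measurableSet_lt (measurable_pi_apply u) measurable_const).inter
    (measurableSet_accepted A u)).compl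

lemma measurableSet_forall_vacant [Countable V] (A T : Finset V) (s : ℝ) :
    MeasurableSet {x | ∀ u ∈ T, x ∈ Vacant G A s u} := by
  have : {x | ∀ u ∈ T, x ∈ Vacant G A s u} = ⋂ u ∈ T, Vacant G A s u := by ext x; simp
  rw [this]
  exact T.measurableSet_biInter fun u _ => measurableSet_vacant A s u

lemma dependsOn_vacant (A S : Finset V) (s : ℝ) (u : V) (hA : A ⊆ S) (hu : u ∈ S) :
    DependsOn (· ∈ Vacant G A s u) (S : Set V) := by
  intro x y hxy
  simp only [Vacant, Set.mem_ofPred_eq, eq_iff_iff]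
  rw [accepted_congr_times fun w hw => hxy w (hA hw), hxy u hu]

/-- On a bipartite graph, vacancy of a site in the class `c` is favoured by late arrivals in the
same class, and early arrivals in the other one. -/
lemma signedIncreasing_vacant {c : V → Prop} (hc : ∀ u w, G.Adj u w → (c u ↔ ¬ c w))
    (A : Finset V) (s : ℝ) {u : V} (hu : c u) : SignedIncreasing c (Vacant G A s u) := by
  rintro x y hxy hyx hx ⟨hlt, hy⟩
  exact hx ⟨(hxy u hu).trans_lt hlt, (accepted_comparison (A := A) (B := A) hc (fun _ _ h => h)
    (fun _ _ h => h) hxy hyx u).1 hu hy⟩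

/-- The probability that the sites of the finite set `T` are vacant just before time `s`, for
blocking RSA on the graph without the vertices in the finite set `R`. The process on the infinite
graph enters as the eventual state along finite vertex sets. -/
noncomputable def vacantProb [DecidableEq V] (G : SimpleGraph V) (R T : Finset V) (s : ℝ) : ℝ :=
  (arrivalLaw V).real {x | ∀ u ∈ T, ∀ᶠ A : Finset V in atTop, x ∈ Vacant G (A \ R) s u}

lemma vacantProb_nonneg [DecidableEq V] (R T : Finset V)
    (s : ℝ) : 0 ≤ vacantProb G R T s := measureReal_nonneg

/-- Vacancy probabilities on the whole graph are limits of those on finite vertex sets. -/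
lemma tendsto_vacantProb [DecidableEq V] [Countable V] [G.LocallyFinite] {d : ℕ}
    (hd : G.IsRegularOfDegree d)
    (R T : Finset V) (s : ℝ) :
    Tendsto (fun A : Finset V => (arrivalLaw V).real {x | ∀ u ∈ T, x ∈ Vacant G (A \ R) s u})
      atTop (𝓝 (vacantProb G R T s)) := by
  refine (ENNReal.tendsto_toReal (measure_ne_top _ _)).comp
    (tendsto_measure_of_ae_tendsto_indicator_of_isFiniteMeasure atTop ?_ ?_ ?_)
  · have : {x | ∀ u ∈ T, ∀ᶠ A : Finset V in atTop, x ∈ Vacant G (A \ R) s u} =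
        ⋂ u ∈ T, ⋃ A : Finset V, ⋂ B : Finset V, ⋂ _ : A ≤ B, Vacant G (B \ R) s u := by
      ext x
      simp [eventually_atTop]
    rw [this]
    exact T.measurableSet_biInter fun u _ => .iUnion fun A => .iInter fun B => .iInter fun _ =>
      measurableSet_vacant _ s u
  · exact fun A => measurableSet_forall_vacant _ T s
  · filter_upwards [ae_exists_finset_accepted_iff hd] with x hx
    have h1 : ∀ u, ∀ᶠ A : Finset V in atTop, (x ∈ Vacant G (A \ R) s u ↔
        ∀ᶠ A : Finset V in atTop, x ∈ Vacant G (A \ R) s u) := by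
      intro u
      obtain ⟨F, hF⟩ := hx u
      have h2 : ∀ A ≥ F, (x ∈ Vacant G (A \ R) s u ↔ x ∈ Vacant G (F \ R) s u) := by
        intro A hA
        have := hF (A \ R) (F \ R) fun z hz => by
          simp only [Finset.mem_sdiff, hz, hA hz]
        simp only [Vacant, Set.mem_ofPred_eq, this]
      have h3 : (∀ᶠ A : Finset V in atTop, x ∈ Vacant G (A \ R) s u) ↔
          x ∈ Vacant G (F \ R) s u := by
        rw [eventually_congr (eventually_atTop.2 ⟨F, h2⟩), eventually_const]
      filter_upwards [eventually_ge_atTop F] with A hA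
      rw [h2 A hA, h3]
    have h4 : ∀ᶠ A : Finset V in atTop, ∀ u ∈ T, (x ∈ Vacant G (A \ R) s u ↔
        ∀ᶠ A : Finset V in atTop, x ∈ Vacant G (A \ R) s u) :=
      (Finset.eventually_all T).2 fun u _ => h1 u
    filter_upwards [h4] with A hA
    exact forall₂_congr hA

/-- The rate at which `v` becomes occupied at time `s` is the probability that its neighbours are
vacant at that time, for blocking RSA without `v`: here on a finite vertex set. -/
lemma one_sub_vacantProb_finite [DecidableEq V] [Countable V] [G.LocallyFinite] {A : Finset V}
    {v : V} (hv : v ∈ A)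
    {t : ℝ} (ht : t ∈ Set.Icc (0 : ℝ) 1) :
    1 - (arrivalLaw V).real (Vacant G A t v) = ∫ s in (0 : ℝ)..t,
      (arrivalLaw V).real {x | ∀ u ∈ G.neighborFinset v, x ∈ Vacant G (A.erase v) s u} := by
  have hm := measurableSet_vacant (G := G) A t v
  rw [← probReal_compl_eq_one_sub hm, measureReal_update v hm.compl]
  have h1 : ∀ s, (arrivalLaw V).real {x | Function.update x v s ∈ (Vacant G A t v)ᶜ} =
      (Set.Iio t).indicator (fun s => (arrivalLaw V).real
        {x | ∀ u ∈ G.neighborFinset v, x ∈ Vacant G (A.erase v) s u}) s := by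
    intro s
    have h2 : ∀ x : V → ℝ, Function.update x v s ∈ (Vacant G A t v)ᶜ ↔
        s < t ∧ ∀ u ∈ G.neighborFinset v, x ∈ Vacant G (A.erase v) s u := by
      intro x
      simp only [Vacant, Set.mem_compl_iff, Set.mem_ofPred_eq, not_not, Function.update_self,
        accepted_update_iff, hv, true_and, SimpleGraph.mem_neighborFinset]
      refine and_congr_right fun _ => ⟨fun h u huv hu => ?_, fun h u _ huv => h u huv.symm⟩
      exact h u (Finset.mem_of_mem_erase hu.2.mem) huv.symm hu
    simp_rw [h2]
    by_cases hs : s < t <;> simp [hs]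
  simp_rw [h1]
  rw [integral_indicator measurableSet_Iio, unif, Measure.restrict_restrict measurableSet_Iio,
    intervalIntegral.integral_of_le ht.1, integral_Ioc_eq_integral_Ioo]
  congr 2
  ext s
  simp only [Set.mem_inter_iff, Set.mem_Iio, Set.mem_Ioo]
  exact ⟨fun h => ⟨h.2.1, h.1⟩, fun h => ⟨h.2, h.1, h.2.trans_le ht.2⟩⟩

/-- Vacancy probabilities are Lipschitz in time, since a change of state requires an arrival. -/
lemma abs_measureReal_vacant_sub_le [Countable V] (A T : Finset V) {s t : ℝ} (hst : s ≤ t) :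
    |(arrivalLaw V).real {x | ∀ u ∈ T, x ∈ Vacant G A s u} -
      (arrivalLaw V).real {x | ∀ u ∈ T, x ∈ Vacant G A t u}| ≤ T.card * (t - s) := by
  set E : ℝ → Set (V → ℝ) := fun s => {x | ∀ u ∈ T, x ∈ Vacant G A s u} with hE
  have hsub : E t ⊆ E s := fun x hx u hu h => hx u hu ⟨h.1.trans_le hst, h.2⟩
  have hcov : E s ⊆ E t ∪ ⋃ u ∈ T, {x | x u ∈ Set.Ico s t} := by
    intro x hx
    by_cases h : x ∈ E t
    · exact Or.inl h
    · right
      simp only [hE, Set.mem_ofPred_eq, not_forall] at h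
      obtain ⟨u, hu, hxu⟩ := h
      rw [Vacant, Set.mem_ofPred_eq, not_not] at hxu
      refine Set.mem_biUnion hu ⟨not_lt.1 fun hlt => hx u hu ⟨hlt, hxu.2⟩, hxu.1⟩
  have h1 : ∀ u, (arrivalLaw V).real {x | x u ∈ Set.Ico s t} ≤ t - s := by
    intro u
    have h2 : arrivalLaw V {x | x u ∈ Set.Ico s t} = unif (Set.Ico s t) :=
      (measurePreserving_eval_infinitePi (fun _ : V => unif) u).measure_preimage
        measurableSet_Ico.nullMeasurableSet
    rw [Measure.real, h2]
    calc (unif (Set.Ico s t)).toReal ≤ (volume (Set.Ico s t)).toReal :=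
          ENNReal.toReal_mono (by simp) (Measure.restrict_apply_le _ _)
      _ = t - s := by simp [hst]
  have h3 : (arrivalLaw V).real (E s) ≤ (arrivalLaw V).real (E t) + T.card * (t - s) :=
    calc (arrivalLaw V).real (E s)
        ≤ (arrivalLaw V).real (E t ∪ ⋃ u ∈ T, {x | x u ∈ Set.Ico s t}) := measureReal_mono hcov
      _ ≤ (arrivalLaw V).real (E t) + (arrivalLaw V).real (⋃ u ∈ T, {x | x u ∈ Set.Ico s t}) :=
          measureReal_union_le _ _
      _ ≤ (arrivalLaw V).real (E t) + ∑ u ∈ T, (arrivalLaw V).real {x | x u ∈ Set.Ico s t} := by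
          gcongr
          exact measureReal_biUnion_finset_le _ _
      _ ≤ (arrivalLaw V).real (E t) + T.card * (t - s) := by
          gcongr
          rw [← nsmul_eq_mul]
          exact Finset.sum_le_card_nsmul _ _ _ fun u _ => h1 u
  rw [abs_of_nonneg (sub_nonneg.2 (measureReal_mono hsub))]
  linarith

lemma continuous_of_abs_sub_le {f : ℝ → ℝ} {C : ℝ}
    (h : ∀ s t, s ≤ t → |f s - f t| ≤ C * (t - s)) : Continuous f := by
  have hC : C ≤ C.toNNReal := Real.le_coe_toNNReal C
  refine (LipschitzWith.of_dist_le_mul (K := C.toNNReal) fun s t => ?_).continuous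
  rw [Real.dist_eq, Real.dist_eq]
  rcases le_total s t with hst | hst
  · rw [abs_sub_comm s t, abs_of_nonneg (sub_nonneg.2 hst)]
    exact (h s t hst).trans (mul_le_mul_of_nonneg_right hC (sub_nonneg.2 hst))
  · rw [abs_sub_comm (f s), abs_of_nonneg (sub_nonneg.2 hst)]
    exact (h t s hst).trans (mul_le_mul_of_nonneg_right hC (sub_nonneg.2 hst))

lemma continuous_vacantProb [DecidableEq V] [Countable V] [G.LocallyFinite] {d : ℕ}
    (hd : G.IsRegularOfDegree d)
    (R T : Finset V) : Continuous (vacantProb G R T) :=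
  continuous_of_abs_sub_le fun s t hst =>
    le_of_tendsto ((tendsto_vacantProb hd R T s).sub (tendsto_vacantProb hd R T t)).abs
      (Eventually.of_forall fun A => abs_measureReal_vacant_sub_le (A \ R) T hst)

/-- The occupation probability at `v` as the integral of the rate at which `v` becomes occupied,
for the graph without the vertices in `R`. -/
lemma one_sub_vacantProb [DecidableEq V] [Countable V] [G.LocallyFinite] {d : ℕ}
    (hd : G.IsRegularOfDegree d)
    {R : Finset V} {v : V} (hv : v ∉ R) {t : ℝ} (ht : t ∈ Set.Icc (0 : ℝ) 1) :
    1 - vacantProb G R {v} t =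
      ∫ s in (0 : ℝ)..t, vacantProb G (insert v R) (G.neighborFinset v) s := by
  have h1 : Tendsto (fun A : Finset V => 1 - (arrivalLaw V).real (Vacant G (A \ R) t v)) atTop
      (𝓝 (1 - vacantProb G R {v} t)) := by
    have := tendsto_vacantProb hd R {v} t
    simp only [Finset.mem_singleton, forall_eq] at this
    exact this.const_sub 1
  have h2 : Tendsto (fun A : Finset V => ∫ s in (0 : ℝ)..t, (arrivalLaw V).real
      {x | ∀ u ∈ G.neighborFinset v, x ∈ Vacant G (A \ insert v R) s u}) atTop
      (𝓝 (∫ s in (0 : ℝ)..t, vacantProb G (insert v R) (G.neighborFinset v) s)) := by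
    refine intervalIntegral.tendsto_integral_filter_of_dominated_convergence (fun _ => 1)
      (Eventually.of_forall fun A => ?_) (Eventually.of_forall fun A => ae_of_all _ fun s _ => ?_)
      intervalIntegrable_const (ae_of_all _ fun s _ => tendsto_vacantProb hd _ _ s)
    · exact (continuous_of_abs_sub_le fun s t hst =>
        abs_measureReal_vacant_sub_le _ _ hst).aestronglyMeasurable
    · rw [Real.norm_of_nonneg measureReal_nonneg]
      exact measureReal_le_one
  refine tendsto_nhds_unique h1 (h2.congr' ?_)
  filter_upwards [eventually_ge_atTop {v}] with A hA
  have hvA : v ∈ A \ R := Finset.mem_sdiff.2 ⟨hA (Finset.mem_singleton_self v), hv⟩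
  rw [one_sub_vacantProb_finite hvA ht, Finset.sdiff_insert]

/-! ### Correlation inequalities for the rates -/

/-- If `w` is vacant at a given time, then it has had no influence on the process up to that time,
so that it may be removed. -/
lemma vacant_inter_vacant_erase_subset [DecidableEq V] (B T : Finset V) (s : ℝ) (w : V) :
    Vacant G B s w ∩ {x | ∀ u ∈ T, x ∈ Vacant G (B.erase w) s u} ⊆
      {x | ∀ u ∈ T, x ∈ Vacant G B s u} := by
  rintro x ⟨hw, hT⟩ u hu ⟨hlt, hacc⟩
  by_cases huw : u = w
  · exact hw (huw ▸ ⟨hlt, hacc⟩)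
  refine hT u hu ⟨hlt, ?_⟩
  by_cases h : Accepted G B x w
  · have hws : s ≤ x w := not_lt.1 fun hws => hw ⟨hws, h⟩
    exact (accepted_erase_of_le huw (hlt.le.trans hws)).1 hacc
  · exact (accepted_erase_of_not_accepted huw h).1 hacc

/-- The bipartition class that contains the neighbours of `v`. -/
lemma exists_class_of_isBipartite (hG : G.IsBipartite) (v : V) :
    ∃ c : V → Prop, (∀ u w, G.Adj u w → (c u ↔ ¬ c w)) ∧ ∀ u, G.Adj v u → c u := by
  obtain ⟨C⟩ := hG
  refine ⟨fun u => C u ≠ C v, fun u w h => ?_, fun u h => (C.valid h).symm⟩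
  have key : ∀ a b e : Fin 2, a ≠ b → (a ≠ e ↔ ¬ b ≠ e) := by decide
  exact key _ _ _ (C.valid h)

/-- The rate at which `v` becomes occupied is bounded below through Harris' inequality, by
singling out one neighbour `w` of `v`. -/
lemma vacantProb_mul_le [DecidableEq V] [Countable V] [G.LocallyFinite] {d : ℕ}
    (hd : G.IsRegularOfDegree d)
    (hG : G.IsBipartite) {v w : V} (hvw : G.Adj v w) (s : ℝ) :
    vacantProb G {v} {w} s * vacantProb G {w, v} (G.neighborFinset v) s ≤
      vacantProb G {v} (G.neighborFinset v) s := by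
  obtain ⟨c, hc, hcv⟩ := exists_class_of_isBipartite hG v
  refine le_of_tendsto_of_tendsto ((tendsto_vacantProb hd {v} {w} s).mul
    (tendsto_vacantProb hd {w, v} (G.neighborFinset v) s))
    (tendsto_vacantProb hd {v} (G.neighborFinset v) s) (Eventually.of_forall fun A => ?_)
  simp only [Finset.mem_singleton, forall_eq]
  rw [Finset.sdiff_insert]
  set B := A \ {v}
  have hm := measurableSet_forall_vacant (G := G) (B.erase w) (G.neighborFinset v) s
  refine (harris_event (c := c) (insert w (B ∪ G.neighborFinset v)) (measurableSet_vacant B s w) hm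
    (signedIncreasing_vacant hc B s (hcv w hvw)) ?_ ?_ ?_).trans
    (measureReal_mono (vacant_inter_vacant_erase_subset B _ s w))
  · exact fun x y hxy hyx hx u hu => signedIncreasing_vacant hc (B.erase w) s
      (hcv u (by simpa using hu)) x y hxy hyx (hx u hu)
  · exact dependsOn_vacant B _ s w (fun z hz => by simp [hz]) (by simp)
  · intro x y hxy
    simp only [eq_iff_iff, Set.mem_ofPred_eq]
    refine forall₂_congr fun u hu => ?_
    have := dependsOn_vacant (G := G) (B.erase w) (insert w (B ∪ G.neighborFinset v)) s u
      (fun z hz => by simp [Finset.mem_of_mem_erase hz]) (by simp at hu; simp [hu]) hxy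
    simpa using this

/-- On a bipartite graph, removing a site of the class of `u` makes `u` more likely to be vacant. -/
lemma vacant_subset_vacant_erase [DecidableEq V] {c : V → Prop}
    (hc : ∀ u w, G.Adj u w → (c u ↔ ¬ c w))
    (B : Finset V) (s : ℝ) {u w : V} (hu : c u) (hw : c w) :
    Vacant G B s u ⊆ Vacant G (B.erase w) s u := by
  rintro x hx ⟨hlt, hacc⟩
  exact hx ⟨hlt, (accepted_comparison (A := B) (B := B.erase w) hc
    (fun _ _ h => Finset.mem_of_mem_erase h)
    (fun z hz h => Finset.mem_erase.2 ⟨fun e => hz (e ▸ hw), h⟩)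
    (fun _ _ => le_rfl) (fun _ _ => le_rfl) u).1 hu hacc⟩

/-- The rate at which `v` becomes occupied in the graph without `w` is bounded below by the product
of the vacancy probabilities of its other neighbours in the graph without `v`, by Harris' inequality
and since keeping `w` only lowers these vacancy probabilities. -/
lemma prod_vacantProb_le [DecidableEq V] [Countable V] [G.LocallyFinite] {d : ℕ}
    (hd : G.IsRegularOfDegree d)
    (hG : G.IsBipartite) {v w : V} (hvw : G.Adj v w) (s : ℝ) :
    ∏ u ∈ (G.neighborFinset v).erase w, vacantProb G {v} {u} s ≤
      vacantProb G {w, v} (G.neighborFinset v) s := by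
  obtain ⟨c, hc, hcv⟩ := exists_class_of_isBipartite hG v
  refine le_of_tendsto_of_tendsto (tendsto_finsetProd _ fun u _ => tendsto_vacantProb hd {v} {u} s)
    (tendsto_vacantProb hd {w, v} (G.neighborFinset v) s) (Eventually.of_forall fun A => ?_)
  simp only [Finset.mem_singleton, forall_eq]
  rw [Finset.sdiff_insert]
  set B := A \ {v}
  have hcN : ∀ u ∈ (G.neighborFinset v).erase w, c u := fun u hu =>
    hcv u (by simpa using Finset.mem_of_mem_erase hu)
  have heq : {x | ∀ u ∈ G.neighborFinset v, x ∈ Vacant G (B.erase w) s u} =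
      {x | ∀ u ∈ (G.neighborFinset v).erase w, x ∈ Vacant G (B.erase w) s u} := by
    ext x
    refine ⟨fun h u hu => h u (Finset.mem_of_mem_erase hu), fun h u hu => ?_⟩
    by_cases huw : u = w
    · subst huw
      exact fun h => Finset.notMem_erase _ _ h.2.mem
    · exact h u (Finset.mem_erase.2 ⟨huw, hu⟩)
  rw [heq]
  refine (Finset.prod_le_prod (fun _ _ => measureReal_nonneg) fun u hu =>
    measureReal_mono (vacant_subset_vacant_erase hc B s (hcN u hu) (hcv w hvw))).trans ?_
  refine harris_prod (c := c) (B ∪ G.neighborFinset v) _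
    (fun u _ => measurableSet_vacant _ s u)
    (fun u hu => signedIncreasing_vacant hc _ s (hcN u hu)) fun u hu =>
    dependsOn_vacant _ _ s u (fun z hz => by simp [Finset.mem_of_mem_erase hz]) ?_
  exact Finset.mem_union_right _ (Finset.mem_of_mem_erase hu)

/-! ### Invariance under automorphisms -/

lemma accepted_map_iso (φ : G ≃g G) (A : Finset V) (x : V → ℝ) (u : V) :
    Accepted G (A.map φ.toEquiv.toEmbedding) x (φ u) ↔ Accepted G A (x ∘ φ) u := by
  by_cases huA : u ∈ A
  swap
  · refine iff_of_false (fun h => huA ?_) fun h => huA h.mem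
    obtain ⟨w, hw, hwu⟩ := Finset.mem_map.1 h.mem
    exact φ.injective hwu ▸ hw
  refine arrival_induction A (x ∘ φ)
    (p := fun u => Accepted G (A.map φ.toEquiv.toEmbedding) x (φ u) ↔ Accepted G A (x ∘ φ) u)
    ?_ u huA
  intro u huA ih
  rw [accepted_iff, accepted_iff (A := A)]
  refine and_congr (iff_of_true (Finset.mem_map_of_mem _ huA) huA) ?_
  constructor
  · intro h w hw hwu hlt
    rw [← ih w hw hlt]
    exact h (φ w) (Finset.mem_map_of_mem _ hw) (φ.map_adj_iff.2 hwu) hlt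
  · intro h w hw hwu hlt
    obtain ⟨z, hz, rfl⟩ := Finset.mem_map.1 hw
    exact (not_congr (ih z hz hlt)).2 (h z hz (φ.map_adj_iff.1 hwu) hlt)

lemma vacantProb_iso [DecidableEq V] [Countable V] [G.LocallyFinite] {d : ℕ}
    (hd : G.IsRegularOfDegree d)
    (φ : G ≃g G) (v w : V) (s : ℝ) :
    vacantProb G {φ v} {φ w} s = vacantProb G {v} {w} s := by
  have h1 := tendsto_vacantProb hd {v} {w} s
  have h2 := tendsto_vacantProb hd {φ v} {φ w} s
  simp only [Finset.mem_singleton, forall_eq] at h1 h2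
  have h3 : Tendsto (fun A : Finset V => A.map φ.toEquiv.toEmbedding) atTop atTop := by
    refine tendsto_atTop.2 fun B => ?_
    filter_upwards [eventually_ge_atTop (B.map φ.symm.toEquiv.toEmbedding)] with A hA z hz
    refine Finset.mem_map.2 ⟨φ.symm z, hA (Finset.mem_map_of_mem _ hz), ?_⟩
    simp
  refine tendsto_nhds_unique (h2.comp h3) (h1.congr fun A => ?_)
  have hm := measurableSet_vacant (G := G) (A \ {v}) s w
  have hmeas : Measurable fun x : V → ℝ => x ∘ φ :=
    measurable_pi_iff.2 fun u => measurable_pi_apply (φ u)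
  have h4 : (arrivalLaw V) (Vacant G (A \ {v}) s w) =
      arrivalLaw V ((fun x : V → ℝ => x ∘ φ) ⁻¹' Vacant G (A \ {v}) s w) := by
    conv_lhs => rw [← arrivalLaw_map_comp φ.toEquiv]
    exact Measure.map_apply hmeas hm
  have h5 : (fun x : V → ℝ => x ∘ φ) ⁻¹' Vacant G (A \ {v}) s w =
      Vacant G (A.map φ.toEquiv.toEmbedding \ {φ v}) s (φ w) := by
    have h6 : A.map φ.toEquiv.toEmbedding \ {φ v} = (A \ {v}).map φ.toEquiv.toEmbedding := by
      rw [Finset.map_sdiff, Finset.map_singleton]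
      rfl
    ext x
    rw [h6]
    simp only [Vacant, Set.mem_preimage, Set.mem_ofPred_eq, accepted_map_iso]
    rfl
  exact congrArg ENNReal.toReal (h4.trans (by rw [h5]; rfl))

/-! ### The differential inequality and the bound for bipartite lattices -/

/-- The consequence of the differential inequality `q' = -g ≤ -q ^ (m + 1)` with `q 0 = 1`. -/
lemma pow_le_of_integral_ineq {m : ℕ} {q g : ℝ → ℝ} (hg : Continuous g)
    (hq : ∀ t ∈ Set.Icc (0 : ℝ) 1, q t = 1 - ∫ s in (0 : ℝ)..t, g s) (hq0 : ∀ t, 0 ≤ q t)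
    (hgq : ∀ t, q t ^ (m + 1) ≤ g t) {t : ℝ} (ht : t ∈ Set.Icc (0 : ℝ) 1) :
    q t ^ m ≤ 1 / (1 + m * t) := by
  rcases Nat.eq_zero_or_pos m with rfl | hm
  · simp
  have hden : 0 < 1 + m * t := by have := ht.1; positivity
  rcases (hq0 t).eq_or_lt with h0 | hpos
  · rw [← h0, zero_pow hm.ne']
    positivity
  set Q : ℝ → ℝ := fun t => 1 - ∫ s in (0 : ℝ)..t, g s with hQ
  have hQd : ∀ s, HasDerivAt Q (-g s) s := fun s =>
    (hg.integral_hasStrictDerivAt 0 s).hasDerivAt.const_sub 1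
  have hg0 : ∀ s, 0 ≤ g s := fun s => (pow_nonneg (hq0 s) _).trans (hgq s)
  have hanti : Antitone Q := antitone_of_hasDerivAt_nonpos hQd fun s => neg_nonpos.2 (hg0 s)
  have hqQ : ∀ s ∈ Set.Icc 0 t, q s = Q s := fun s hs => hq s ⟨hs.1, hs.2.trans ht.2⟩
  have hQpos : ∀ s ∈ Set.Icc 0 t, 0 < Q s := fun s hs => by
    have := hanti hs.2
    rw [← hqQ t ⟨ht.1, le_rfl⟩] at this
    exact hpos.trans_le this
  -- `Q ^ (-m)` grows at least as fast as the solution `1 + m t` of the equality case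
  have hmono : MonotoneOn (fun s => (Q s ^ m)⁻¹ - m * s) (Set.Icc 0 t) := by
    have hder : ∀ s ∈ Set.Icc 0 t, HasDerivAt (fun s => (Q s ^ m)⁻¹ - m * s)
        (-(m * Q s ^ (m - 1) * -g s) / (Q s ^ m) ^ 2 - m) s := fun s hs => by
      have h1 := ((hQd s).fun_pow m).fun_inv (pow_pos (hQpos s hs) m).ne'
      have h2 := (hasDerivAt_id s).const_mul (m : ℝ)
      rw [mul_one] at h2
      exact h1.sub h2
    refine monotoneOn_of_deriv_nonneg (convex_Icc 0 t)
      (fun s hs => (hder s hs).continuousAt.continuousWithinAt)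
      (fun s hs => (hder s (interior_subset hs)).differentiableAt.differentiableWithinAt)
      fun s hs => ?_
    have hs' := interior_subset hs
    rw [(hder s hs').deriv, sub_nonneg, le_div_iff₀ (by have := hQpos s hs'; positivity)]
    have hgs : Q s ^ (m + 1) ≤ g s := hqQ s hs' ▸ hgq s
    have hQs := (hQpos s hs').le
    calc (m : ℝ) * (Q s ^ m) ^ 2 = m * Q s ^ (m - 1) * Q s ^ (m + 1) := by
          rw [mul_assoc, ← pow_add, ← pow_mul]
          congr 2
          omega
      _ ≤ m * Q s ^ (m - 1) * g s := by gcongr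
      _ = _ := by ring
  have h := hmono (Set.left_mem_Icc.2 ht.1) (Set.right_mem_Icc.2 ht.1) ht.1
  have hQ0 : Q 0 = 1 := by simp [hQ]
  simp only [hQ0, one_pow, inv_one, mul_zero, sub_zero] at h
  rw [hqQ t (Set.right_mem_Icc.2 ht.1), le_div_iff₀ hden]
  have hp : 0 < Q t ^ m := pow_pos (hQpos t (Set.right_mem_Icc.2 ht.1)) m
  calc Q t ^ m * (1 + m * t) ≤ Q t ^ m * (Q t ^ m)⁻¹ := by gcongr; linarith
    _ = 1 := mul_inv_cancel₀ hp.ne'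

/-- `q * g = -q * q'` integrates to `(1 - q ^ 2) / 2`. -/
lemma integral_mul_eq_of_integral_eq {q g : ℝ → ℝ} (hg : Continuous g)
    (hq : ∀ t ∈ Set.Icc (0 : ℝ) 1, q t = 1 - ∫ s in (0 : ℝ)..t, g s) {t : ℝ}
    (ht : t ∈ Set.Icc (0 : ℝ) 1) : ∫ s in (0 : ℝ)..t, q s * g s = (1 - q t ^ 2) / 2 := by
  set Q : ℝ → ℝ := fun t => 1 - ∫ s in (0 : ℝ)..t, g s with hQ
  have hQd : ∀ s, HasDerivAt Q (-g s) s := fun s =>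
    (hg.integral_hasStrictDerivAt 0 s).hasDerivAt.const_sub 1
  have hQc : Continuous Q := continuous_iff_continuousAt.2 fun s => (hQd s).continuousAt
  have h1 : ∫ s in (0 : ℝ)..t, q s * g s = ∫ s in (0 : ℝ)..t, Q s * g s := by
    refine intervalIntegral.integral_congr fun s hs => ?_
    rw [Set.uIcc_of_le ht.1] at hs
    simp only [hq s ⟨hs.1, hs.2.trans ht.2⟩, hQ]
  have h2 : ∀ s ∈ Set.uIcc 0 t, HasDerivAt (fun s => -(Q s ^ 2) / 2) (Q s * g s) s := fun s _ => by
    refine (((hQd s).fun_pow 2).fun_neg.div_const 2).congr_deriv ?_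
    push_cast
    ring
  rw [h1, intervalIntegral.integral_eq_sub_of_hasDerivAt h2
    ((hQc.mul hg).intervalIntegrable _ _), hq t ht]
  simp [hQ]
  ring

/-- The bound for the vacancy probability at a site of a bipartite lattice. On the regular tree all
the inequalities for the rates are equalities, and so is this one. -/
theorem vacantProb_le [DecidableEq V] [Countable V] [G.LocallyFinite] {k : ℕ} (hk : 2 ≤ k)
    (hd : G.IsRegularOfDegree (k + 1)) (hG : IsBipartiteLattice G) (v : V) {t : ℝ}
    (ht : t ∈ Set.Icc (0 : ℝ) 1) :
    vacantProb G ∅ {v} t ≤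
      1 / 2 * (1 + 1 / (1 + ((k : ℝ) - 1) * t) ^ (2 / ((k : ℝ) - 1))) := by
  obtain ⟨m, rfl⟩ : ∃ m, k = m + 1 := ⟨k - 1, by omega⟩
  have hm : 0 < m := by omega
  obtain ⟨w, hvw⟩ : ∃ w, G.Adj v w := by
    rw [← SimpleGraph.degree_pos_iff_exists_adj, hd v]
    omega
  set q : ℝ → ℝ := vacantProb G {v} {w} with hq
  set g : ℝ → ℝ := vacantProb G {w, v} (G.neighborFinset v) with hg
  have hsymm : ∀ {a b}, G.Adj a b → vacantProb G {a} {b} = q := fun {a b} hab => by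
    obtain ⟨φ, rfl, rfl⟩ := hG.transitive v w a b hvw hab
    exact funext fun s => vacantProb_iso hd φ v w s
  have hgc : Continuous g := continuous_vacantProb hd _ _
  have hqi : ∀ t ∈ Set.Icc (0 : ℝ) 1, q t = 1 - ∫ s in (0 : ℝ)..t, g s := fun t ht => by
    have := one_sub_vacantProb (R := {w}) (v := v) hd (by simpa using hvw.ne) ht
    rw [hsymm hvw.symm, Finset.pair_comm] at this
    rw [← this]
    ring
  have hgq : ∀ t, q t ^ (m + 1) ≤ g t := fun t => by
    refine le_trans (le_of_eq ?_) (prod_vacantProb_le hd hG.bipartite hvw t)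
    rw [Finset.prod_congr rfl fun u hu => congrFun (hsymm (a := v) (b := u) (by
      simpa using Finset.mem_of_mem_erase hu)) t, Finset.prod_const,
      Finset.card_erase_of_mem (by simpa using hvw), SimpleGraph.card_neighborFinset_eq_degree,
      hd v, Nat.add_sub_cancel]
  have hq0 : ∀ t, 0 ≤ q t := fun t => vacantProb_nonneg _ _ _
  have h1 : (1 - q t ^ 2) / 2 ≤ 1 - vacantProb G ∅ {v} t := by
    rw [one_sub_vacantProb hd (Finset.notMem_empty v) ht,
      ← integral_mul_eq_of_integral_eq hgc hqi ht]
    refine intervalIntegral.integral_mono_on ht.1 ?_ ?_ fun s _ =>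
      vacantProb_mul_le hd hG.bipartite hvw s
    · exact ((continuous_vacantProb hd _ _).mul hgc).intervalIntegrable _ _
    · exact (continuous_vacantProb hd _ _).intervalIntegrable _ _
  have h2 := pow_le_of_integral_ineq hgc hqi hq0 hgq ht
  have hm' : (0 : ℝ) < m := by exact_mod_cast hm
  have hden : 0 < 1 + m * t := by have := ht.1; positivity
  have h3 : q t ^ 2 ≤ 1 / (1 + (m : ℝ) * t) ^ (2 / (m : ℝ)) := by
    have h4 : q t ^ 2 = (q t ^ m) ^ (2 / (m : ℝ)) := by
      rw [← Real.rpow_natCast, ← Real.rpow_natCast, ← Real.rpow_mul (hq0 t)]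
      congr 1
      field_simp
      norm_num
    rw [h4]
    refine (Real.rpow_le_rpow (pow_nonneg (hq0 t) m) h2 (by positivity)).trans (le_of_eq ?_)
    rw [Real.div_rpow zero_le_one hden.le, Real.one_rpow]
  have h5 : ((m + 1 : ℕ) : ℝ) - 1 = m := by push_cast; ring
  rw [h5]
  linarith

/-! ### Convergence of the states -/

/-- If finitely many sites determine the fate of the particle at `v`, then the states for finite
vertex sets converge. -/
lemma exists_finset_state_eq {x : V → ℝ} {v : V} (h : ∃ F : Finset V, ∀ A B : Finset V,
    (∀ z ∈ F, z ∈ A ↔ z ∈ B) → (Accepted G A x v ↔ Accepted G B x v)) (t : ℝ) :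
    ∃ F : Finset V, ∀ A, F ⊆ A → stateOn G A x t v = state G x t v := by
  obtain ⟨F, hF⟩ := h
  have h1 : ∀ A, F ⊆ A → stateOn G A x t v = stateOn G F x t v := fun A hA => by
    have := hF A F fun z hz => iff_of_true (hA hz) hz
    unfold stateOn
    split_ifs <;> simp_all
  have h2 : state G x t v = stateOn G F x t v :=
    Tendsto.limUnder_eq (tendsto_const_nhds.congr' (by
      filter_upwards [eventually_ge_atTop F] with A hA
      exact (h1 A hA).symm))
  exact ⟨F, fun A hA => (h1 A hA).trans h2.symm⟩

/-- Almost surely, the process is well defined as a limit along finite vertex sets. -/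
theorem ae_tendsto_state [Countable V] [G.LocallyFinite] {d : ℕ} (hd : G.IsRegularOfDegree d) :
    ∀ᵐ x ∂arrivalLaw V, ∀ v : V, ∀ t : ℝ, ∀ W : ℕ → Finset V,
      liminf (fun n => (W n : Set V)) atTop = Set.univ →
      Tendsto (fun n => stateOn G (W n) x t v) atTop (𝓝 (state G x t v)) := by
  filter_upwards [ae_exists_finset_accepted_iff hd] with x hx v t W hW
  obtain ⟨F, hF⟩ := exists_finset_state_eq (hx v) t
  have h1 : ∀ᶠ n in atTop, ∀ z ∈ F, z ∈ W n := (Finset.eventually_all F).2 fun z _ => by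
    have : z ∈ liminf (fun n => (W n : Set V)) atTop := hW ▸ Set.mem_univ z
    exact mem_liminf_iff_eventually_mem.1 this
  refine tendsto_const_nhds.congr' ?_
  filter_upwards [h1] with n hn
  exact (hF (W n) hn).symm

lemma measureReal_state_eq_zero_le [DecidableEq V] [Countable V] [G.LocallyFinite] {d : ℕ}
    (hd : G.IsRegularOfDegree d) (v : V) (t : ℝ) :
    (arrivalLaw V).real {x | state G x t v = 0} ≤ vacantProb G ∅ {v} t := by
  refine ENNReal.toReal_mono (measure_ne_top _ _) (measure_mono_ae ?_)
  filter_upwards [ae_exists_finset_accepted_iff hd] with x hx (h0 : state G x t v = 0)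
  obtain ⟨F, hF⟩ := exists_finset_state_eq (hx v) t
  show ∀ u ∈ ({v} : Finset V), ∀ᶠ A : Finset V in atTop, x ∈ Vacant G (A \ ∅) t u
  simp only [Finset.mem_singleton, forall_eq, Finset.sdiff_empty]
  filter_upwards [eventually_ge_atTop F] with A hA hacc
  have := hF A hA
  rw [h0, stateOn, if_pos ⟨hacc.1.le, hacc.2⟩] at this
  exact one_ne_zero this

/-! ### The integer lattices -/

lemma sum_sq_eq_one_iff {d : ℕ} {z : Fin d → ℤ} :
    ∑ i, z i ^ 2 = 1 ↔ ∃ (i : Fin d) (ε : ℤˣ), z = Pi.single i (ε : ℤ) := by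
  constructor
  · intro h
    obtain ⟨i, hi⟩ : ∃ i, z i ≠ 0 := by
      by_contra! hcon
      simp [hcon] at h
    rw [← Finset.add_sum_erase _ _ (Finset.mem_univ i)] at h
    have h1 : 0 ≤ ∑ j ∈ Finset.univ.erase i, z j ^ 2 := Finset.sum_nonneg fun j _ => sq_nonneg _
    have h2 : 0 < z i ^ 2 := by positivity
    have h3 : ∑ j ∈ Finset.univ.erase i, z j ^ 2 = 0 := by omega
    have h4 : z i ^ 2 = 1 := by omega
    rw [Finset.sum_eq_zero_iff_of_nonneg fun j _ => sq_nonneg _] at h3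
    refine ⟨i, Units.mk (z i) (z i) (by rw [← sq, h4]) (by rw [← sq, h4]), funext fun j => ?_⟩
    by_cases hj : j = i
    · subst hj; simp
    · rw [Pi.single_eq_of_ne hj]
      exact pow_eq_zero_iff two_ne_zero |>.1 (h3 j (Finset.mem_erase.2 ⟨hj, Finset.mem_univ j⟩))
  · rintro ⟨i, ε, rfl⟩
    rw [Finset.sum_eq_single i (fun j _ hj => by simp [hj]) (by simp), Pi.single_eq_same]
    rw [sq, Int.units_coe_mul_self]

lemma integerLattice_adj_iff {d : ℕ} {x y : Fin d → ℤ} :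
    (integerLattice d).Adj x y ↔ ∃ (i : Fin d) (ε : ℤˣ), y = x - Pi.single i (ε : ℤ) := by
  have : (integerLattice d).Adj x y ↔ ∑ i, (x - y) i ^ 2 = 1 := Iff.rfl
  rw [this, sum_sq_eq_one_iff]
  refine exists_congr fun i => exists_congr fun ε => ⟨fun h => ?_, fun h => ?_⟩
  · rw [← h]; abel
  · rw [h]; abel

/-- The isometry of `ℤ^d` that maps `v` to `w`, with linear part the exchange of the coordinates
`i` and `j` followed by multiplication by the sign `ε`. -/
def latticeIso {d : ℕ} (v w : Fin d → ℤ) (i j : Fin d) (ε : ℤˣ) :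
    integerLattice d ≃g integerLattice d where
  toFun x m := w m + ε * (x (Equiv.swap i j m) - v (Equiv.swap i j m))
  invFun y m := v m + ε * (y (Equiv.swap i j m) - w (Equiv.swap i j m))
  left_inv x := by
    funext m
    have : (ε : ℤ) * ε = 1 := Int.units_coe_mul_self ε
    simp [← mul_assoc, this]
  right_inv x := by
    funext m
    have : (ε : ℤ) * ε = 1 := Int.units_coe_mul_self ε
    simp [← mul_assoc, this]
  map_rel_iff' := by
    intro x y
    have hε : (ε : ℤ) ^ 2 = 1 := by rw [sq, Int.units_coe_mul_self]
    have h : ∀ m, (w m + ε * (x (Equiv.swap i j m) - v (Equiv.swap i j m)) -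
        (w m + ε * (y (Equiv.swap i j m) - v (Equiv.swap i j m)))) ^ 2 =
        (x (Equiv.swap i j m) - y (Equiv.swap i j m)) ^ 2 := fun m => by
      linear_combination (x (Equiv.swap i j m) - y (Equiv.swap i j m)) ^ 2 * hε
    change ∑ m, _ = _ ↔ ∑ m, _ = _
    simp only [Equiv.coe_fn_mk, h]
    rw [Equiv.sum_comp (Equiv.swap i j) fun m => (x m - y m) ^ 2]

lemma isBipartiteLattice_integerLattice (d : ℕ) : IsBipartiteLattice (integerLattice d) where
  bipartite := by
    have C : (integerLattice d).Coloring Bool :=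
      SimpleGraph.Coloring.mk (fun x => decide (Even (∑ i, x i))) fun {x y} h => by
        obtain ⟨i, ε, rfl⟩ := integerLattice_adj_iff.1 h
        simp only [Pi.sub_apply, Finset.sum_sub_distrib, Finset.sum_pi_single', Finset.mem_univ,
          if_true, ne_eq, decide_eq_decide, Int.even_sub]
        have : ¬ Even (ε : ℤ) := by
          rcases Int.units_eq_one_or ε with rfl | rfl <;> decide
        tauto
    exact C.colorable
  transitive := by
    intro v₁ v₂ w₁ w₂ hv hw
    obtain ⟨i, ε, rfl⟩ := integerLattice_adj_iff.1 hv
    obtain ⟨j, δ, rfl⟩ := integerLattice_adj_iff.1 hw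
    refine ⟨latticeIso v₁ w₁ i j (ε * δ), funext fun m => ?_, funext fun m => ?_⟩
    · simp [latticeIso]
    · have hε : (ε : ℤ) * ε = 1 := Int.units_coe_mul_self ε
      have h1 : (Pi.single i (ε : ℤ) : Fin d → ℤ) (Equiv.swap i j m) =
          (Pi.single j (ε : ℤ) : Fin d → ℤ) m := by
        simp only [Pi.single_apply, Equiv.swap_apply_eq_iff, Equiv.swap_apply_left]
      have h2 : (latticeIso v₁ w₁ i j (ε * δ)) (v₁ - Pi.single i (ε : ℤ)) m =
          w₁ m + ((ε * δ : ℤˣ) : ℤ) * ((v₁ - Pi.single i (ε : ℤ) : Fin d → ℤ) (Equiv.swap i j m) -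
            v₁ (Equiv.swap i j m)) := rfl
      rw [h2, Pi.sub_apply, Pi.sub_apply, h1]
      by_cases hm : m = j
      · subst hm
        simp only [Pi.single_eq_same, Units.val_mul]
        linear_combination (-(δ : ℤ)) * hε
      · simp [Pi.single_eq_of_ne hm]

lemma encard_neighborSet_integerLattice {d : ℕ} (v : Fin d → ℤ) :
    ((integerLattice d).neighborSet v).encard = ((2 * d : ℕ) : ℕ∞) := by
  have h1 : (integerLattice d).neighborSet v =
      Set.range fun p : Fin d × ℤˣ => v - Pi.single p.1 (p.2 : ℤ) := by
    ext y
    rw [SimpleGraph.mem_neighborSet, integerLattice_adj_iff]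
    simp [eq_comm]
  have hinj : Function.Injective fun p : Fin d × ℤˣ => v - Pi.single p.1 (p.2 : ℤ) := by
    rintro ⟨i, ε⟩ ⟨j, δ⟩ h
    have h2 : (Pi.single i (ε : ℤ) : Fin d → ℤ) = Pi.single j (δ : ℤ) := sub_right_injective h
    have hij : i = j := by
      by_contra hij
      have := congrFun h2 i
      rw [Pi.single_eq_same, Pi.single_eq_of_ne hij] at this
      exact ε.ne_zero this
    subst hij
    rw [Units.ext (Pi.single_injective i h2)]
  rw [h1, ← Set.image_univ, hinj.encard_image, Set.encard_univ, ENat.card_eq_coe_fintype_card, Fintype.card_prod, Fintype.card_fin,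
    Fintype.card_units_int, mul_comm]

/-! ### The hexagonal lattice -/

lemma hexagonalLattice_adj_iff {a b a' b' : ℤ} {c c' : Bool} :
    hexagonalLattice.Adj (a, b, c) (a', b', c') ↔
      (c = false ∧ c' = true ∧ ((a' = a ∧ b' = b) ∨ (a' = a - 1 ∧ b' = b) ∨
        (a' = a ∧ b' = b - 1))) ∨
      (c' = false ∧ c = true ∧ ((a = a' ∧ b = b') ∨ (a = a' - 1 ∧ b = b') ∨
        (a = a' ∧ b = b' - 1))) := by
  rw [hexagonalLattice, SimpleGraph.fromRel_adj]
  cases c <;> cases c' <;> simp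

/-- Translations of the hexagonal lattice. -/
def hexTranslation (m n : ℤ) : hexagonalLattice ≃g hexagonalLattice where
  toFun x := (x.1 + m, x.2.1 + n, x.2.2)
  invFun x := (x.1 - m, x.2.1 - n, x.2.2)
  left_inv x := by simp
  right_inv x := by simp
  map_rel_iff' := by
    rintro ⟨a, b, c⟩ ⟨a', b', c'⟩
    simp only [Equiv.coe_fn_mk, hexagonalLattice_adj_iff]
    cases c <;> cases c' <;> simp <;> omega

/-- The half-turn of the hexagonal lattice about the midpoint of an edge. -/
def hexInversion : hexagonalLattice ≃g hexagonalLattice where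
  toFun x := (-x.1, -x.2.1, !x.2.2)
  invFun x := (-x.1, -x.2.1, !x.2.2)
  left_inv x := by simp
  right_inv x := by simp
  map_rel_iff' := by
    rintro ⟨a, b, c⟩ ⟨a', b', c'⟩
    simp only [Equiv.coe_fn_mk, hexagonalLattice_adj_iff]
    cases c <;> cases c' <;> simp <;> omega

/-- The rotation of the hexagonal lattice by 120 degrees about the vertex `(0, 0, false)`. -/
def hexRotation : hexagonalLattice ≃g hexagonalLattice where
  toFun x := (-x.1 - x.2.1 - (if x.2.2 then 1 else 0), x.1, x.2.2)
  invFun x := (x.2.1, -x.1 - x.2.1 - (if x.2.2 then 1 else 0), x.2.2)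
  left_inv x := by
    ext <;> simp
    ring
  right_inv x := by
    ext <;> simp
    ring
  map_rel_iff' := by
    rintro ⟨a, b, c⟩ ⟨a', b', c'⟩
    simp only [Equiv.coe_fn_mk, hexagonalLattice_adj_iff]
    cases c <;> cases c' <;> simp <;> omega

/-- Every arc is the image of the arc from `(0, 0, false)` to `(0, 0, true)`. -/
lemma exists_hexagonalLattice_iso {v w : ℤ × ℤ × Bool} (h : hexagonalLattice.Adj v w) :
    ∃ φ : hexagonalLattice ≃g hexagonalLattice, φ (0, 0, false) = v ∧ φ (0, 0, true) = w := by
  have key : ∀ {v w : ℤ × ℤ × Bool}, hexagonalLattice.Adj v w → v.2.2 = false →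
      ∃ φ : hexagonalLattice ≃g hexagonalLattice, φ (0, 0, false) = v ∧ φ (0, 0, true) = w := by
    rintro ⟨a, b, c⟩ ⟨a', b', c'⟩ h hc
    rw [hexagonalLattice_adj_iff] at h
    obtain rfl : c = false := hc
    rcases h with ⟨-, rfl, ⟨rfl, rfl⟩ | ⟨rfl, rfl⟩ | ⟨rfl, rfl⟩⟩ | ⟨-, hc, -⟩
    · exact ⟨hexTranslation a' b', by simp [hexTranslation], by simp [hexTranslation]⟩
    · exact ⟨hexRotation.trans (hexTranslation a b'), by simp [hexTranslation, hexRotation],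
        by simp [hexTranslation, hexRotation]; omega⟩
    · exact ⟨(hexRotation.trans hexRotation).trans (hexTranslation a' b),
        by simp [hexTranslation, hexRotation], by simp [hexTranslation, hexRotation]; omega⟩
    · simp at hc
  cases hc : v.2.2 with
  | false => exact key h hc
  | true =>
    obtain ⟨φ, h1, h2⟩ := key (hexInversion.map_adj_iff.2 h) (by simp [hexInversion, hc])
    refine ⟨φ.trans hexInversion, ?_, ?_⟩
    · simp [h1, hexInversion]
    · simp [h2, hexInversion]

lemma isBipartiteLattice_hexagonalLattice : IsBipartiteLattice hexagonalLattice where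
  bipartite := by
    have C : hexagonalLattice.Coloring Bool :=
      SimpleGraph.Coloring.mk (fun x => x.2.2) fun {x y} h => by
        obtain ⟨a, b, c⟩ := x
        obtain ⟨a', b', c'⟩ := y
        rw [hexagonalLattice_adj_iff] at h
        rcases h with ⟨rfl, rfl, -⟩ | ⟨rfl, rfl, -⟩ <;> simp
    exact C.colorable
  transitive := by
    intro v₁ v₂ w₁ w₂ hv hw
    obtain ⟨φ, rfl, rfl⟩ := exists_hexagonalLattice_iso hv
    obtain ⟨ψ, rfl, rfl⟩ := exists_hexagonalLattice_iso hw
    exact ⟨φ.symm.trans ψ, by simp, by simp⟩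

lemma encard_neighborSet_hexagonalLattice (v : ℤ × ℤ × Bool) :
    (hexagonalLattice.neighborSet v).encard = 3 := by
  obtain ⟨a, b, c⟩ := v
  rw [Set.encard_eq_three]
  cases c with
  | false =>
    refine ⟨(a, b, true), (a - 1, b, true), (a, b - 1, true),
      by simp; omega, by simp; omega, by simp, ?_⟩
    ext ⟨a', b', c'⟩
    simp only [SimpleGraph.mem_neighborSet, hexagonalLattice_adj_iff]
    cases c' <;> simp
  | true =>
    refine ⟨(a, b, false), (a + 1, b, false), (a, b + 1, false), by simp, by simp, by simp, ?_⟩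
    ext ⟨a', b', c'⟩
    simp only [SimpleGraph.mem_neighborSet, hexagonalLattice_adj_iff]
    cases c' <;> simp
    omega

/-! ### Numerical values -/

lemma abs_five_rpow_sub_lt : |1 / 2 * (1 - (5 : ℝ) ^ (-(1 / 2) : ℝ)) - 0.2764| < 0.00005 := by
  have h0 : (0 : ℝ) < (5 : ℝ) ^ (-(1 / 2) : ℝ) := by positivity
  have h1 : ((5 : ℝ) ^ (-(1 / 2) : ℝ)) ^ 2 = 1 / 5 := by
    rw [← Real.rpow_natCast, ← Real.rpow_mul (by norm_num)]
    norm_num [Real.rpow_neg_one]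
  generalize (5 : ℝ) ^ (-(1 / 2) : ℝ) = x at *
  rw [abs_lt]
  constructor <;> nlinarith

lemma abs_seven_rpow_sub_lt : |1 / 2 * (1 - (7 : ℝ) ^ (-(1 / 3) : ℝ)) - 0.2386| < 0.00005 := by
  have h0 : (0 : ℝ) < (7 : ℝ) ^ (-(1 / 3) : ℝ) := by positivity
  have h1 : ((7 : ℝ) ^ (-(1 / 3) : ℝ)) ^ 3 = 1 / 7 := by
    rw [← Real.rpow_natCast, ← Real.rpow_mul (by norm_num)]
    norm_num [Real.rpow_neg_one]
  generalize (7 : ℝ) ^ (-(1 / 3) : ℝ) = x at *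
  have h2 : x < 0.5229 := lt_of_pow_lt_pow_left₀ 3 (by norm_num) (by rw [h1]; norm_num)
  have h3 : 0.5227 < x := lt_of_pow_lt_pow_left₀ 3 h0.le (by rw [h1]; norm_num)
  rw [abs_lt]
  constructor <;> linarith

/-! ### Transfer to arbitrary arrival times -/

lemma isRegularOfDegree_of_encard [G.LocallyFinite] {d : ℕ}
    (h : ∀ v, (G.neighborSet v).encard = (d : ℕ∞)) : G.IsRegularOfDegree d := by
  intro v
  have := h v
  rw [← SimpleGraph.coe_neighborFinset, Set.encard_coe_eq_coe_finsetCard] at this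
  exact_mod_cast this

section Transfer

variable {Ω : Type*} [MeasurableSpace Ω] {P : Measure Ω} [IsProbabilityMeasure P] [Countable V]
  {τ : V → Ω → ℝ}

lemma IsArrivalTimes.ae_tendsto_state (hτ : IsArrivalTimes P τ) {d : ℕ}
    (hd : ∀ v, (G.neighborSet v).encard = (d : ℕ∞)) :
    ∀ᵐ ω ∂P, ∀ v : V, ∀ t : ℝ, ∀ W : ℕ → Finset V,
      liminf (fun n => (W n : Set V)) atTop = Set.univ →
      Tendsto (fun n => stateOn G (W n) (fun u => τ u ω) t v) atTop
        (𝓝 (state G (fun u => τ u ω) t v)) := by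
  have : G.LocallyFinite := fun v => (Set.finite_of_encard_eq_coe (hd v)).fintype
  have h := BlockingRSA.ae_tendsto_state (isRegularOfDegree_of_encard hd)
  rw [← hτ.map_eq] at h
  exact ae_of_ae_map (measurable_pi_iff.2 hτ.measurable).aemeasurable h

lemma IsArrivalTimes.state_zero_le (hτ : IsArrivalTimes P τ) {k : ℕ} (hk : 2 ≤ k)
    (hG : IsBipartiteLattice G) (hd : ∀ v, (G.neighborSet v).encard = ((k + 1 : ℕ) : ℕ∞)) (v : V)
    {t : ℝ} (ht : t ∈ Set.Icc (0 : ℝ) 1) :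
    P.real {ω | state G (fun u => τ u ω) t v = 0} ≤
      1 / 2 * (1 + 1 / (1 + ((k : ℝ) - 1) * t) ^ (2 / ((k : ℝ) - 1))) := by
  classical
  have : G.LocallyFinite := fun v => (Set.finite_of_encard_eq_coe (hd v)).fintype
  have hd' := isRegularOfDegree_of_encard hd
  refine le_trans ?_ (vacantProb_le hk hd' hG v ht)
  refine le_trans ?_ (measureReal_state_eq_zero_le hd' v t)
  rw [← hτ.map_eq]
  exact ENNReal.toReal_mono (measure_ne_top _ _)
    (Measure.le_map_apply (measurable_pi_iff.2 hτ.measurable).aemeasurable _)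

lemma IsArrivalTimes.state_one_zero_le (hτ : IsArrivalTimes P τ) {k : ℕ} (hk : 2 ≤ k)
    (hG : IsBipartiteLattice G) (hd : ∀ v, (G.neighborSet v).encard = ((k + 1 : ℕ) : ℕ∞)) (v : V) :
    P.real {ω | state G (fun u => τ u ω) 1 v = 0} ≤
      1 / 2 * (1 + (k : ℝ) ^ (-(2 / ((k : ℝ) - 1)))) := by
  have h := hτ.state_zero_le hk hG hd v (t := 1) (by simp)
  rwa [mul_one, add_sub_cancel, one_div ((k : ℝ) ^ _), ← Real.rpow_neg (Nat.cast_nonneg k)] at h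

lemma IsArrivalTimes.le_state_one_one (hτ : IsArrivalTimes P τ) {k : ℕ} (hk : 2 ≤ k)
    (hG : IsBipartiteLattice G) (hd : ∀ v, (G.neighborSet v).encard = ((k + 1 : ℕ) : ℕ∞)) (v : V) :
    1 / 2 * (1 - (k : ℝ) ^ (-(2 / ((k : ℝ) - 1)))) ≤
      P.real {ω | state G (fun u => τ u ω) 1 v = 1} := by
  have h := hτ.state_one_zero_le hk hG hd v
  have hcov : {ω | state G (fun u => τ u ω) 1 v = 0} ∪ {ω | state G (fun u => τ u ω) 1 v = 1} =
      Set.univ := by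
    ext ω
    have : ∀ a : Fin 2, a = 0 ∨ a = 1 := by decide
    simpa using this _
  have h1 := measureReal_union_le (μ := P) {ω | state G (fun u => τ u ω) 1 v = 0}
    {ω | state G (fun u => τ u ω) 1 v = 1}
  rw [hcov, probReal_univ] at h1
  linarith

end Transfer

end BlockingRSA

theorem theorem6 {Ω : Type*} [MeasurableSpace Ω] (P : Measure Ω) [IsProbabilityMeasure P] :
    -- the general bounds for a bipartite lattice whose vertices have degree `k + 1`
    (∀ (V : Type*) [Countable V] (G : SimpleGraph V) (k : ℕ) (τ : V → Ω → ℝ),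
      2 ≤ k → BlockingRSA.IsBipartiteLattice G →
      (∀ v, (G.neighborSet v).encard = ((k + 1 : ℕ) : ℕ∞)) →
      BlockingRSA.IsArrivalTimes P τ →
        -- the process is almost surely well defined as a limit of processes on finite subgraphs
        (∀ᵐ ω ∂P, ∀ v : V, ∀ t ∈ Set.Icc (0 : ℝ) 1, ∀ W : ℕ → Finset V,
          liminf (fun n => (W n : Set V)) atTop = Set.univ →
          Tendsto (fun n => BlockingRSA.stateOn G (W n) (fun u => τ u ω) t v) atTop
            (𝓝 (BlockingRSA.state G (fun u => τ u ω) t v))) ∧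
        ∀ v : V,
          (∀ t ∈ Set.Icc (0 : ℝ) 1,
            P.real {ω | BlockingRSA.state G (fun u => τ u ω) t v = 0} ≤
              1 / 2 * (1 + 1 / (1 + ((k : ℝ) - 1) * t) ^ (2 / ((k : ℝ) - 1)))) ∧
          P.real {ω | BlockingRSA.state G (fun u => τ u ω) 1 v = 0} ≤
            1 / 2 * (1 + (k : ℝ) ^ (-(2 / ((k : ℝ) - 1)))) ∧
          1 / 2 * (1 - (k : ℝ) ^ (-(2 / ((k : ℝ) - 1)))) ≤
            P.real {ω | BlockingRSA.state G (fun u => τ u ω) 1 v = 1}) ∧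
    -- the integer lattices and the hexagonal lattice are bipartite lattices, with these degrees
    (∀ d : ℕ, BlockingRSA.IsBipartiteLattice (BlockingRSA.integerLattice d) ∧
      ∀ v, ((BlockingRSA.integerLattice d).neighborSet v).encard = ((2 * d : ℕ) : ℕ∞)) ∧
    (BlockingRSA.IsBipartiteLattice BlockingRSA.hexagonalLattice ∧
      ∀ v, (BlockingRSA.hexagonalLattice.neighborSet v).encard = 3) ∧
    -- the square lattice
    (∀ τ : (Fin 2 → ℤ) → Ω → ℝ, BlockingRSA.IsArrivalTimes P τ → ∀ v : Fin 2 → ℤ,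
      (∀ t ∈ Set.Icc (0 : ℝ) 1,
        P.real {ω | BlockingRSA.state (BlockingRSA.integerLattice 2) (fun u => τ u ω) t v = 0} ≤
          (1 + t) / (1 + 2 * t)) ∧
      1 / 3 ≤
        P.real {ω | BlockingRSA.state (BlockingRSA.integerLattice 2) (fun u => τ u ω) 1 v = 1}) ∧
    -- the hexagonal lattice
    (∀ τ : ℤ × ℤ × Bool → Ω → ℝ, BlockingRSA.IsArrivalTimes P τ → ∀ v : ℤ × ℤ × Bool,
      3 / 8 ≤
        P.real {ω | BlockingRSA.state BlockingRSA.hexagonalLattice (fun u => τ u ω) 1 v = 1}) ∧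
    -- the integer lattices in dimensions three and four
    (∀ τ : (Fin 3 → ℤ) → Ω → ℝ, BlockingRSA.IsArrivalTimes P τ → ∀ v : Fin 3 → ℤ,
      1 / 2 * (1 - (5 : ℝ) ^ (-(1 / 2) : ℝ)) ≤
        P.real {ω | BlockingRSA.state (BlockingRSA.integerLattice 3) (fun u => τ u ω) 1 v = 1}) ∧
    |1 / 2 * (1 - (5 : ℝ) ^ (-(1 / 2) : ℝ)) - 0.2764| < 0.00005 ∧
    (∀ τ : (Fin 4 → ℤ) → Ω → ℝ, BlockingRSA.IsArrivalTimes P τ → ∀ v : Fin 4 → ℤ,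
      1 / 2 * (1 - (7 : ℝ) ^ (-(1 / 3) : ℝ)) ≤
        P.real {ω | BlockingRSA.state (BlockingRSA.integerLattice 4) (fun u => τ u ω) 1 v = 1}) ∧
    |1 / 2 * (1 - (7 : ℝ) ^ (-(1 / 3) : ℝ)) - 0.2386| < 0.00005 := by
  refine ⟨fun V _ G k τ hk hG hd hτ => ⟨?_, fun v => ⟨fun t ht => hτ.state_zero_le hk hG hd v ht,
    hτ.state_one_zero_le hk hG hd v, hτ.le_state_one_one hk hG hd v⟩⟩,
    fun d => ⟨BlockingRSA.isBipartiteLattice_integerLattice d,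
      BlockingRSA.encard_neighborSet_integerLattice⟩,
    ⟨BlockingRSA.isBipartiteLattice_hexagonalLattice,
      BlockingRSA.encard_neighborSet_hexagonalLattice⟩,
    fun τ hτ v => ⟨fun t ht => ?_, ?_⟩, fun τ hτ v => ?_, fun τ hτ v => ?_,
    BlockingRSA.abs_five_rpow_sub_lt, fun τ hτ v => ?_, BlockingRSA.abs_seven_rpow_sub_lt⟩
  · filter_upwards [hτ.ae_tendsto_state hd] with ω hω v t _ W hW using hω v t W hW
  · have h := hτ.state_zero_le (k := 3) (by norm_num)
      (BlockingRSA.isBipartiteLattice_integerLattice 2)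
      BlockingRSA.encard_neighborSet_integerLattice v ht
    have h1 : 0 < 1 + 2 * t := by linarith [ht.1]
    refine h.trans (le_of_eq ?_)
    norm_num
    field_simp
    ring
  · refine le_trans (le_of_eq ?_) (hτ.le_state_one_one (k := 3) (by norm_num)
      (BlockingRSA.isBipartiteLattice_integerLattice 2)
      BlockingRSA.encard_neighborSet_integerLattice v)
    norm_num [Real.rpow_neg_one]
  · refine le_trans (le_of_eq ?_) (hτ.le_state_one_one (k := 2) le_rfl
      BlockingRSA.isBipartiteLattice_hexagonalLattice
      BlockingRSA.encard_neighborSet_hexagonalLattice v)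
    have h1 : (2 : ℝ) ^ (-2 : ℝ) = 1 / 4 := by
      rw [Real.rpow_neg (by norm_num), Real.rpow_two]
      norm_num
    norm_num [h1]
  · refine le_trans (le_of_eq ?_) (hτ.le_state_one_one (k := 5) (by norm_num)
      (BlockingRSA.isBipartiteLattice_integerLattice 3)
      BlockingRSA.encard_neighborSet_integerLattice v)
    norm_num
  · refine le_trans (le_of_eq ?_) (hτ.le_state_one_one (k := 7) (by norm_num)
      (BlockingRSA.isBipartiteLattice_integerLattice 4)
      BlockingRSA.encard_neighborSet_integerLattice v)
    norm_num
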